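/- **Theorem 6.7.** Semirings are associative with $0$ and $1$, where $0$ is absorbing; semimodules are unital left semimodules with $s0=0=0m$. A semiring $S$ is *left subtractive* if for every left ideal $I$ of $S$ and all $x,y\in S$, $x\in I$ and $x+y\in I$ imply $y\in I$. In the category of left $S$-semimodules, and likewise in that of commutative monoids, a sequence $0\to A\xrightarrow{f}B\xrightarrow{g}C\to 0$ is *short exact* if $f$ is a kernel of $g$ and $g$ is a cokernel of $f$ (in the sense of the universal properties, with respect to zero morphisms). A left $S$-semimodule $M$ is *e-injective* if for each short exact sequence $0\to A\to B\to C\to 0$ of left $S$-semimodules the induced sequence $0\to \mathrm{Hom}_S(C,M)\to \mathrm{Hom}_S(B,M)\to \mathrm{Hom}_S(A,M)\to 0$ of commutative monoids is short exact. A semimodule is *finitely generated* (*cyclic*) if it is a homomorphic image of $S^n$ for some $n\in\mathbb N$ (of $S$). Let $S$ be a left subtractive semiring. The following conditions are equivalent: 1. all finitely generated left $S$-semimodules are e-injective; 2. all cyclic left $S$-semimodules are e-injective; 3. $S\cong R\oplus T$ as semirings (direct product), where $R$ is a (classical) semisimple ring and $T$ is a finite Boolean algebra, regarded as a semiring with join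 as addition and meet as multiplication. Here $R$ may be the zero ring and $T$ may be the one-element Boolean algebra. -/

import Mathlib

/-!
Semirings are associative with `0` and `1` (`Semiring S`), left semimodules are
`[AddCommMonoid M] [Module S M]`, and homomorphisms of semimodules are `S`-linear maps.
Finitely generated is `Module.Finite S M`, cyclic is `Module.IsPrincipal S M`.
-/

universe u

namespace EInj

/-- A subsemimodule `A` of `M` is subtractive: `m, m + m' ∈ A` implies `m' ∈ A`. -/
def IsSubtractive {S : Type*} [Semiring S] {M : Type*} [AddCommMonoid M] [Module S M]
    (A : Submodule S M) : Prop :=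
  ∀ m m' : M, m ∈ A → m + m' ∈ A → m' ∈ A

/-- A semiring is left subtractive if all its left ideals, that is, all subsemimodules of the left
regular semimodule, are subtractive. -/
def IsLeftSubtractive (S : Type*) [Semiring S] : Prop :=
  ∀ I : Submodule S S, IsSubtractive I

section Semimodules

variable {S : Type u} [Semiring S]
variable {A B C : Type u} [AddCommMonoid A] [AddCommMonoid B] [AddCommMonoid C]
variable [Module S A] [Module S B] [Module S C]

/-- `f : A → B` is a kernel of `g : B → C` in the category of left `S`-semimodules. -/
def IsKernel (f : A →ₗ[S] B) (g : B →ₗ[S] C) : Prop :=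
  g ∘ₗ f = 0 ∧
    ∀ (X : Type u) [AddCommMonoid X] [Module S X] (x : X →ₗ[S] B), g ∘ₗ x = 0 →
      ∃! i : X →ₗ[S] A, f ∘ₗ i = x

/-- `g : B → C` is a cokernel of `f : A → B` in the category of left `S`-semimodules. -/
def IsCokernel (f : A →ₗ[S] B) (g : B →ₗ[S] C) : Prop :=
  g ∘ₗ f = 0 ∧
    ∀ (X : Type u) [AddCommMonoid X] [Module S X] (x : B →ₗ[S] X), x ∘ₗ f = 0 →
      ∃! i : C →ₗ[S] X, i ∘ₗ g = x

/-- The sequence `0 → A → B → C → 0` of left `S`-semimodules, with maps `f` and `g`, is short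
exact: `f` is a kernel of `g` and `g` is a cokernel of `f`. -/
def IsShortExact (f : A →ₗ[S] B) (g : B →ₗ[S] C) : Prop :=
  IsKernel f g ∧ IsCokernel f g

/-- The map `Hom(f, M) : Hom(B, M) → Hom(A, M)` of commutative monoids given by precomposition
with `f : A → B`. -/
def precomp (M : Type u) [AddCommMonoid M] [Module S M] (f : A →ₗ[S] B) :
    (B →ₗ[S] M) →+ (A →ₗ[S] M) where
  toFun ψ := ψ ∘ₗ f
  map_zero' := LinearMap.zero_comp f
  map_add' φ ψ := LinearMap.add_comp f ψ φ

end Semimodules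

section Monoids

variable {A B C : Type u} [AddCommMonoid A] [AddCommMonoid B] [AddCommMonoid C]

/-- `f : A → B` is a kernel of `g : B → C` in the category of commutative monoids. -/
def IsMonoidKernel (f : A →+ B) (g : B →+ C) : Prop :=
  g.comp f = 0 ∧
    ∀ (X : Type u) [AddCommMonoid X] (x : X →+ B), g.comp x = 0 → ∃! i : X →+ A, f.comp i = x

/-- `g : B → C` is a cokernel of `f : A → B` in the category of commutative monoids. -/
def IsMonoidCokernel (f : A →+ B) (g : B →+ C) : Prop :=
  g.comp f = 0 ∧
    ∀ (X : Type u) [AddCommMonoid X] (x : B →+ X), x.comp f = 0 → ∃! i : C →+ X, i.comp g = x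

/-- The sequence `0 → A → B → C → 0` of commutative monoids is short exact. -/
def IsMonoidShortExact (f : A →+ B) (g : B →+ C) : Prop :=
  IsMonoidKernel f g ∧ IsMonoidCokernel f g

end Monoids

/-- A left `S`-semimodule `M` is e-injective: the contravariant functor `Hom(-, M)` from left
`S`-semimodules to commutative monoids takes every short exact sequence `0 → A → B → C → 0` to a
short exact sequence `0 → Hom(C, M) → Hom(B, M) → Hom(A, M) → 0`. -/
def EInjective (S : Type u) [Semiring S] (M : Type u) [AddCommMonoid M] [Module S M] : Prop :=
  ∀ (A B C : Type u) [AddCommMonoid A] [AddCommMonoid B] [AddCommMonoid C]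
    [Module S A] [Module S B] [Module S C] (f : A →ₗ[S] B) (g : B →ₗ[S] C),
    IsShortExact f g → IsMonoidShortExact (precomp M g) (precomp M f)

/-- The semiring `T` is a Boolean algebra, with join as addition and meet as multiplication. -/
def IsBooleanAlgebra (T : Type*) [Semiring T] : Prop :=
  ∃ _ : BooleanAlgebra T,
    (∀ a b : T, a + b = a ⊔ b) ∧ (∀ a b : T, a * b = a ⊓ b) ∧ (0 : T) = ⊥ ∧ (1 : T) = ⊤

end EInj

/-! A cokernel `g` of `f` in commutative monoids is a surjection for which `g b = g b'` forces `b +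
f a = b' + f a'`. So e-injectivity of `M` asks two things along a subtractive inclusion A ⊆ B:
homomorphisms A → M extend to B, and homomorphisms on B that agree on A become equal after adding
homomorphisms vanishing on A (`EInjective.of_extension`).

For 3 ⇒ 1, write 1 as the sum of the unit of R and the atoms of T; both conditions may be checked
one summand at a time. On the ring summand they follow from injectivity over a semisimple ring and
from subtraction. For an atom t, tM is a semilattice, with a largest element when M is finitely
generated. Elements b with tb outside A can be sent to it, because A is subtractive.

For 2 ⇒ 3, let V be the ideal of additively invertible elements. Extending the identity of S/V to a
suitable larger semimodule yields t absorbing everything modulo V (`exists_absorbing`).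
Subtractivity puts 1 into V + St, which splits S into a ring and a semiring with x + 1 = 1
(`exists_splitting`). Both factors inherit the Baer-type condition `CyclicExt`. It implies von
Neumann regularity, and Osofsky's argument (`CyclicExt.false_of_orthogonal`) excludes infinite
orthogonal families of nonzero idempotents. Hence the ring is semisimple. In the other factor
regularity and x + 1 = 1 force commuting idempotents, the second condition supplies complements, and
Osofsky's argument gives finiteness. -/

namespace EInj

/-! ### Quotients by congruences and by subsemimodules. -/

section Quotients

variable {S : Type*} [Semiring S] {M N : Type*} [AddCommMonoid M] [AddCommMonoid N]
variable [Module S M] [Module S N]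

/-- The projection onto the quotient by a congruence, as a linear map. -/
def conMk (c : ModuleCon S M) : M →ₗ[S] c.Quotient where
  toFun x := Quotient.mk'' x
  map_add' _ _ := rfl
  map_smul' _ _ := rfl

theorem conMk_surjective (c : ModuleCon S M) : Function.Surjective (conMk c) :=
  Quotient.mk''_surjective

theorem conMk_eq_iff (c : ModuleCon S M) {x y : M} : conMk c x = conMk c y ↔ c.r x y :=
  Quotient.eq''

/-- The linear map induced on a quotient by a linear map compatible with the congruence. -/
def conLift (c : ModuleCon S M) (f : M →ₗ[S] N) (h : ∀ x y, c.r x y → f x = f y) :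
    c.Quotient →ₗ[S] N where
  toFun := Quotient.lift f h
  map_add' := by rintro ⟨x⟩ ⟨y⟩; exact map_add f x y
  map_smul' := by rintro s ⟨x⟩; exact map_smul f s x

/-- The Bourne congruence of a subsemimodule `A`: `x ~ y` iff `x + a = y + b` with
`a, b ∈ A`. -/
def bourneCon (A : Submodule S M) : ModuleCon S M where
  r x y := ∃ a ∈ A, ∃ b ∈ A, x + a = y + b
  iseqv :=
    { refl := fun x => ⟨0, A.zero_mem, 0, A.zero_mem, rfl⟩
      symm := fun ⟨a, ha, b, hb, h⟩ => ⟨b, hb, a, ha, h.symm⟩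
      trans := by
        rintro x y z ⟨a, ha, b, hb, h⟩ ⟨a', ha', b', hb', h'⟩
        refine ⟨a + a', A.add_mem ha ha', b' + b, A.add_mem hb' hb, ?_⟩
        rw [← add_assoc, h, add_right_comm, h', add_assoc] }
  add' := by
    rintro w x y z ⟨a, ha, b, hb, h⟩ ⟨a', ha', b', hb', h'⟩
    refine ⟨a + a', A.add_mem ha ha', b + b', A.add_mem hb hb', ?_⟩
    rw [add_add_add_comm, h, h', add_add_add_comm]
  smul := by
    rintro s x y ⟨a, ha, b, hb, h⟩
    exact ⟨s • a, A.smul_mem s ha, s • b, A.smul_mem s hb, by rw [← smul_add, h, smul_add]⟩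

/-- The projection onto the quotient by the Bourne congruence. -/
def bourneMk (A : Submodule S M) : M →ₗ[S] (bourneCon A).Quotient := conMk _

theorem bourneMk_surjective (A : Submodule S M) : Function.Surjective (bourneMk A) :=
  conMk_surjective _

theorem bourneMk_eq_iff (A : Submodule S M) {x y : M} :
    bourneMk A x = bourneMk A y ↔ ∃ a ∈ A, ∃ b ∈ A, x + a = y + b :=
  conMk_eq_iff _

theorem bourneMk_eq_zero {A : Submodule S M} {x : M} (hx : x ∈ A) : bourneMk A x = 0 := by
  rw [← map_zero (bourneMk A), bourneMk_eq_iff]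
  exact ⟨0, A.zero_mem, x, hx, by rw [add_zero, zero_add]⟩

end Quotients

/-! ### Elementwise form of kernels and cokernels of semimodules. -/

section Exactness

variable {S : Type u} [Semiring S]
variable {A B C : Type u} [AddCommMonoid A] [AddCommMonoid B] [AddCommMonoid C]
variable [Module S A] [Module S B] [Module S C]

theorem IsKernel.of_injective {f : A →ₗ[S] B} {g : B →ₗ[S] C} (hf : Function.Injective f)
    (hfg : ∀ b, g b = 0 ↔ b ∈ LinearMap.range f) : IsKernel f g := by
  refine ⟨LinearMap.ext fun a => (hfg _).2 ⟨a, rfl⟩, fun X _ _ x hx => ?_⟩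
  have hx' (t : X) : x t ∈ LinearMap.range f := (hfg _).1 (LinearMap.congr_fun hx t)
  choose i hi using hx'
  refine ⟨⟨⟨i, fun s t => hf ?_⟩, fun s t => hf ?_⟩, LinearMap.ext hi, fun j hj => ?_⟩
  · rw [map_add, hi, hi, hi, map_add]
  · simp only [RingHom.id_apply]
    rw [map_smul, hi, hi, map_smul]
  · ext t
    exact hf ((LinearMap.congr_fun hj t).trans (hi t).symm)

theorem IsCokernel.of_surjective {f : A →ₗ[S] B} {g : B →ₗ[S] C} (hg : Function.Surjective g)
    (hgf : g ∘ₗ f = 0) (h : ∀ b b', g b = g b' → ∃ a a', b + f a = b' + f a') :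
    IsCokernel f g := by
  refine ⟨hgf, fun X _ _ x hx => ?_⟩
  have key (b b' : B) (hb : g b = g b') : x b = x b' := by
    obtain ⟨a, a', e⟩ := h b b' hb
    have e' := congrArg x e
    have hxf (a : A) : x (f a) = 0 := LinearMap.congr_fun hx a
    simpa [hxf] using e'
  choose s hs using hg
  refine ⟨⟨⟨fun c => x (s c), fun c d => ?_⟩, fun r c => ?_⟩,
    LinearMap.ext fun b => key _ _ (hs _), fun j hj => ?_⟩
  · rw [← map_add]
    exact key _ _ (by rw [hs, map_add, hs, hs])
  · simp only [RingHom.id_apply]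
    rw [← map_smul]
    exact key _ _ (by rw [hs, map_smul, hs])
  · ext c
    exact (congrArg j (hs c)).symm.trans (LinearMap.congr_fun hj (s c))

/-- Elements of `A` are homomorphisms `S → A`, so testing the universal property on `S` suffices. -/
theorem IsKernel.injective {f : A →ₗ[S] B} {g : B →ₗ[S] C} (h : IsKernel f g) :
    Function.Injective f := by
  intro a a' e
  obtain ⟨i, -, hi⟩ := h.2 S (f ∘ₗ LinearMap.toSpanSingleton S A a)
    (by rw [← LinearMap.comp_assoc, h.1, LinearMap.zero_comp])
  have h1 := hi (LinearMap.toSpanSingleton S A a) rfl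
  have h2 := hi (LinearMap.toSpanSingleton S A a') (by ext; simp [e])
  simpa using LinearMap.congr_fun (h1.trans h2.symm) 1

theorem IsKernel.mem_range {f : A →ₗ[S] B} {g : B →ₗ[S] C} (h : IsKernel f g) {b : B}
    (hb : g b = 0) : b ∈ LinearMap.range f := by
  obtain ⟨i, hi, -⟩ := h.2 S (LinearMap.toSpanSingleton S B b) (by ext; simp [hb])
  exact ⟨i 1, by simpa using LinearMap.congr_fun hi 1⟩

theorem IsKernel.isSubtractive_range {f : A →ₗ[S] B} {g : B →ₗ[S] C} (h : IsKernel f g) :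
    IsSubtractive (LinearMap.range f) := by
  have h0 (a : A) : g (f a) = 0 := LinearMap.congr_fun h.1 a
  rintro m m' ⟨a, rfl⟩ ⟨a', ha'⟩
  refine h.mem_range ?_
  have := congrArg g ha'
  simpa [h0] using this.symm

end Exactness

/-! ### Elementwise form of cokernels of monoids. -/

section MonoidExactness

variable {A B C : Type u} [AddCommMonoid A] [AddCommMonoid B] [AddCommMonoid C]

theorem IsMonoidCokernel.of_surjective {f : A →+ B} {g : B →+ C} (hg : Function.Surjective g)
    (hgf : g.comp f = 0) (h : ∀ b b', g b = g b' → ∃ a a', b + f a = b' + f a') :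
    IsMonoidCokernel f g := by
  refine ⟨hgf, fun X _ x hx => ?_⟩
  have key (b b' : B) (hb : g b = g b') : x b = x b' := by
    obtain ⟨a, a', e⟩ := h b b' hb
    have e' := congrArg x e
    have hxf (a : A) : x (f a) = 0 := DFunLike.congr_fun hx a
    simpa [hxf] using e'
  choose s hs using hg
  refine ⟨⟨⟨fun c => x (s c), (key _ _ (by rw [hs, map_zero])).trans (map_zero x)⟩,
    fun c d => ?_⟩, AddMonoidHom.ext fun b => key _ _ (hs _), fun j hj => ?_⟩
  · simp only
    rw [← map_add]
    exact key _ _ (by rw [hs, map_add, hs, hs])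
  · ext c
    exact (congrArg j (hs c)).symm.trans (DFunLike.congr_fun hj (s c))

/-- A cokernel of monoids is isomorphic to the explicit one, the quotient by the Bourne
congruence of the image. -/
theorem IsMonoidCokernel.surjective_and {f : A →+ B} {g : B →+ C} (h : IsMonoidCokernel f g) :
    Function.Surjective g ∧ ∀ b b', g b = g b' → ∃ a a', b + f a = b' + f a' := by
  set N := LinearMap.range f.toNatLinearMap
  set q : B →+ (bourneCon N).Quotient := (bourneMk N).toAddMonoidHom
  have hq : Function.Surjective q := bourneMk_surjective N
  obtain ⟨i, hi, -⟩ := h.2 _ q (AddMonoidHom.ext fun a => bourneMk_eq_zero ⟨a, rfl⟩)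
  have hgN (x y : B) (hxy : (bourneCon N).r x y) : g x = g y := by
    obtain ⟨_, ⟨a, rfl⟩, _, ⟨b, rfl⟩, e⟩ := hxy
    have hgf (a : A) : g (f a) = 0 := DFunLike.congr_fun h.1 a
    simpa [hgf] using congrArg g e
  set j : (bourneCon N).Quotient →+ C :=
    (conLift (bourneCon N) g.toNatLinearMap hgN).toAddMonoidHom
  have hj (b : B) : j (q b) = g b := rfl
  have hiq (b : B) : i (g b) = q b := DFunLike.congr_fun hi b
  have hji : j.comp i = AddMonoidHom.id C := by
    obtain ⟨k, -, hk⟩ := h.2 _ g h.1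
    refine (hk _ ?_).trans (hk _ rfl).symm
    ext b
    simp [hiq, hj]
  refine ⟨fun c => ?_, fun b b' e => ?_⟩
  · obtain ⟨b, hb⟩ := hq (i c)
    exact ⟨b, by rw [← hj, hb]; exact DFunLike.congr_fun hji c⟩
  · have : q b = q b' := by rw [← hiq, e, hiq]
    obtain ⟨_, ⟨a, rfl⟩, _, ⟨a', rfl⟩, e⟩ := (bourneMk_eq_iff N).1 this
    exact ⟨a, a', e⟩

end MonoidExactness

/-! ### Elementwise form of e-injectivity. -/

section EInjective

variable {S : Type u} [Semiring S] {M : Type u} [AddCommMonoid M] [Module S M]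
variable {A B C : Type u} [AddCommMonoid A] [AddCommMonoid B] [AddCommMonoid C]
variable [Module S A] [Module S B] [Module S C]

theorem EInjective.exists_extension (hM : EInjective S M) {f : A →ₗ[S] B} {g : B →ₗ[S] C}
    (h : IsShortExact f g) (φ : A →ₗ[S] M) : ∃ ψ : B →ₗ[S] M, ψ ∘ₗ f = φ :=
  (hM A B C f g h).2.surjective_and.1 φ

theorem EInjective.exists_add_eq (hM : EInjective S M) {f : A →ₗ[S] B} {g : B →ₗ[S] C}
    (h : IsShortExact f g) {φ ψ : B →ₗ[S] M} (e : φ ∘ₗ f = ψ ∘ₗ f) :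
    ∃ α β : B →ₗ[S] M, α ∘ₗ f = 0 ∧ β ∘ₗ f = 0 ∧ φ + α = ψ + β := by
  obtain ⟨a, b, hab⟩ := (hM A B C f g h).2.surjective_and.2 φ ψ e
  exact ⟨_, _, DFunLike.congr_fun (hM A B C f g h).1.1 a,
    DFunLike.congr_fun (hM A B C f g h).1.1 b, hab⟩

/-- `Hom(-, M)` always turns the cokernel `g` into a kernel, so only the cokernel half needs the
hypotheses; homomorphisms vanishing on the image of `f` factor through `g`. -/
theorem EInjective.of_extension
    (hext : ∀ (A B : Type u) [AddCommMonoid A] [AddCommMonoid B] [Module S A] [Module S B]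
      (f : A →ₗ[S] B), Function.Injective f → IsSubtractive (LinearMap.range f) →
      ∀ φ : A →ₗ[S] M, ∃ ψ : B →ₗ[S] M, ψ ∘ₗ f = φ)
    (hadd : ∀ (A B : Type u) [AddCommMonoid A] [AddCommMonoid B] [Module S A] [Module S B]
      (f : A →ₗ[S] B), IsSubtractive (LinearMap.range f) →
      ∀ φ ψ : B →ₗ[S] M, φ ∘ₗ f = ψ ∘ₗ f →
        ∃ α β : B →ₗ[S] M, α ∘ₗ f = 0 ∧ β ∘ₗ f = 0 ∧ φ + α = ψ + β) :
    EInjective S M := by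
  intro A B C _ _ _ _ _ _ f g h
  have hgf : (precomp M f).comp (precomp M g) = 0 := by
    ext φ a
    exact (congrArg φ (LinearMap.congr_fun h.1.1 a)).trans (map_zero φ)
  refine ⟨⟨hgf, fun X _ x hx => ?_⟩, ?_⟩
  · have hx' (t : X) : x t ∘ₗ f = 0 := DFunLike.congr_fun hx t
    choose i hi hu using fun t => h.2.2 M (x t) (hx' t)
    refine ⟨⟨⟨i, ?_⟩, fun s t => ?_⟩, AddMonoidHom.ext hi, fun j hj => ?_⟩
    · exact (hu 0 0 (by simp)).symm
    · refine (hu (s + t) (i s + i t) ?_).symm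
      simp only [LinearMap.add_comp, map_add]
      rw [hi, hi]
    · ext1 t
      exact hu t _ (DFunLike.congr_fun hj t)
  · refine .of_surjective (fun φ => ?_) hgf fun φ ψ e => ?_
    · exact hext A B f h.1.injective h.1.isSubtractive_range φ
    · obtain ⟨α, β, hα, hβ, e⟩ := hadd A B f h.1.isSubtractive_range φ ψ e
      obtain ⟨a, ha, -⟩ := h.2.2 M α hα
      obtain ⟨b, hb, -⟩ := h.2.2 M β hβ
      refine ⟨a, b, ?_⟩
      change φ + a ∘ₗ g = ψ + b ∘ₗ g
      rw [ha, hb, e]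

/-- Subtractivity is exactly what keeps the zero class of the Bourne congruence from exceeding `A`.
-/
theorem isShortExact_bourneMk {A : Submodule S B} (hA : IsSubtractive A) :
    IsShortExact A.subtype (bourneMk A) := by
  refine ⟨.of_injective A.subtype_injective fun b => ?_,
    .of_surjective (bourneMk_surjective A) (LinearMap.ext fun a => bourneMk_eq_zero a.2)
      fun b b' e => ?_⟩
  · rw [Submodule.range_subtype]
    refine ⟨fun h => ?_, bourneMk_eq_zero⟩
    rw [← map_zero (bourneMk A), bourneMk_eq_iff] at h
    obtain ⟨a, ha, a', ha', e⟩ := h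
    refine hA a b ha ?_
    rwa [add_comm, e, zero_add]
  · obtain ⟨a, ha, a', ha', e⟩ := (bourneMk_eq_iff A).1 e
    exact ⟨⟨a, ha⟩, ⟨a', ha'⟩, e⟩

end EInjective

/-- Every homomorphism from a left ideal to a cyclic semimodule is right multiplication by an
element. -/
def CyclicExt (S : Type u) [Semiring S] : Prop :=
  ∀ (M : Type u) [AddCommMonoid M] [Module S M], Module.IsPrincipal S M →
    ∀ (I : Submodule S S) (φ : I →ₗ[S] M), ∃ m : M, ∀ x : I, φ x = (x : S) • m

/-! ### The Baer-type condition and the core of Osofsky's argument. -/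

section

variable {S : Type u} [Semiring S]

theorem isPrincipal_of_surjective {M : Type*} [AddCommMonoid M] [Module S M] (g : S →ₗ[S] M)
    (hg : Function.Surjective g) : Module.IsPrincipal S M := by
  refine ⟨g 1, (Submodule.eq_top_iff'.2 fun y => ?_).symm⟩
  obtain ⟨s, rfl⟩ := hg y
  exact Submodule.mem_span_singleton.2 ⟨s, by rw [← map_smul, smul_eq_mul, mul_one]⟩

theorem isPrincipal_quotient (c : ModuleCon S S) : Module.IsPrincipal S c.Quotient :=
  isPrincipal_of_surjective (conMk c) (conMk_surjective c)

theorem isPrincipal_self : Module.IsPrincipal S S :=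
  isPrincipal_of_surjective LinearMap.id Function.surjective_id

/-- Left subtractivity makes each left ideal a kernel, so `φ` extends to `S`; `m` is the value at
`1`. -/
theorem cyclicExt_of_eInjective (hS : IsLeftSubtractive S)
    (h : ∀ (M : Type u) [AddCommMonoid M] [Module S M],
      Module.IsPrincipal S M → EInjective S M) : CyclicExt S := by
  intro M _ _ hM I φ
  obtain ⟨ψ, hψ⟩ := (h M hM).exists_extension (isShortExact_bourneMk (hS I)) φ
  refine ⟨ψ 1, fun x => ?_⟩
  rw [← map_smul, smul_eq_mul, mul_one, ← hψ]
  rfl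

/-- The identity and right multiplication by `f` agree on `S f`, hence become equal after adding
homomorphisms that vanish at `f`; `a` and `b` are the values of these at `1`. -/
theorem exists_complement_of_eInjective (hS : IsLeftSubtractive S) (h : EInjective S S) {f : S}
    (hf : f * f = f) : ∃ a b : S, 1 + a = f + b ∧ f * a = 0 ∧ f * b = 0 := by
  have hfI : f ∈ Submodule.span S {f} := Submodule.mem_span_singleton_self f
  obtain ⟨α, β, hα, hβ, e⟩ := h.exists_add_eq
    (isShortExact_bourneMk (hS (Submodule.span S {f})))
    (φ := LinearMap.id) (ψ := LinearMap.toSpanSingleton S S f) (by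
      ext ⟨x, hx⟩
      obtain ⟨s, rfl⟩ := Submodule.mem_span_singleton.1 hx
      simp [mul_assoc, hf])
  have hev (γ : S →ₗ[S] S) : f * γ 1 = γ f := by rw [← smul_eq_mul, ← map_smul]; simp
  refine ⟨α 1, β 1, by simpa using LinearMap.congr_fun e 1, ?_, ?_⟩
  · exact (hev α).trans (LinearMap.congr_fun hα ⟨f, hfI⟩)
  · exact (hev β).trans (LinearMap.congr_fun hβ ⟨f, hfI⟩)

theorem CyclicExt.of_surjective (hS : CyclicExt S) {R : Type u} [Semiring R] (π : S →+* R)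
    (hπ : Function.Surjective π) : CyclicExt R := by
  intro M _ _ hM I φ
  let _ : Module S M := Module.compHom M π
  have hsm (s : S) (m : M) : s • m = π s • m := rfl
  have hM' : Module.IsPrincipal S M := by
    obtain ⟨m, hm⟩ := hM
    refine ⟨m, (Submodule.eq_top_iff'.2 fun y => ?_).symm⟩
    obtain ⟨r, rfl⟩ := Submodule.mem_span_singleton.1 (hm ▸ Submodule.mem_top : y ∈ _)
    obtain ⟨s, rfl⟩ := hπ r
    exact Submodule.mem_span_singleton.2 ⟨s, rfl⟩
  obtain ⟨m, hm⟩ := hS M hM' (Ideal.comap π I)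
    { toFun := fun x => φ ⟨π x, x.2⟩
      map_add' := fun x y => by
        rw [← map_add]
        exact congrArg φ (Subtype.ext (map_add π _ _))
      map_smul' := fun s x => by
        rw [RingHom.id_apply, hsm, ← map_smul]
        exact congrArg φ (Subtype.ext (map_mul π _ _)) }
  refine ⟨m, fun ⟨x, hx⟩ => ?_⟩
  obtain ⟨s, rfl⟩ := hπ x
  exact hm ⟨s, hx⟩

/-- A semiring with `CyclicExt` is von Neumann regular. -/
theorem CyclicExt.regular (hS : CyclicExt S) (a : S) : ∃ b, a * b * a = a := by
  -- The cyclic target is `S a` itself: its identity is right multiplication by some `b * a`.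
  obtain ⟨⟨m, hm⟩, h⟩ := hS (Submodule.span S {a})
    ((Module.isPrincipal_submodule_iff).2 inferInstance) (Submodule.span S {a}) LinearMap.id
  obtain ⟨b, rfl⟩ := Submodule.mem_span_singleton.1 hm
  refine ⟨b, ?_⟩
  have := congrArg Subtype.val (h ⟨a, Submodule.mem_span_singleton_self a⟩)
  simpa [mul_assoc] using this.symm

/-- For a directed family `c` in a cyclic semimodule, sending `x` to the eventual value of
`x • c F`, where it exists, is right multiplication by an element. -/
theorem CyclicExt.exists_eventual (hS : CyclicExt S) {M : Type u} [AddCommMonoid M] [Module S M]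
    (hM : Module.IsPrincipal S M) {ι : Type*} [Preorder ι] [IsDirectedOrder ι] [Nonempty ι]
    (c : ι → M) :
    ∃ m : M, ∀ (x : S) (F : ι), (∀ G, F ≤ G → x • c G = x • c F) → x • m = x • c F := by
  let I : Submodule S S :=
    { carrier := {x | ∃ F, ∀ G, F ≤ G → x • c G = x • c F}
      zero_mem' := ⟨Classical.arbitrary ι, fun G _ => by rw [zero_smul, zero_smul]⟩
      add_mem' := by
        rintro x y ⟨F, hF⟩ ⟨F', hF'⟩
        obtain ⟨H, h1, h2⟩ := exists_ge_ge F F'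
        refine ⟨H, fun G hG => ?_⟩
        rw [add_smul, add_smul, hF G (h1.trans hG), hF H h1, hF' G (h2.trans hG), hF' H h2]
      smul_mem' := by
        rintro s x ⟨F, hF⟩
        exact ⟨F, fun G hG => by rw [smul_eq_mul, mul_smul, mul_smul, hF G hG]⟩ }
  have hI (x : I) : ∃ F, ∀ G, F ≤ G → (x : S) • c G = (x : S) • c F := x.2
  choose F hF using hI
  have key (x : I) (G : ι) (hG : ∀ H, G ≤ H → (x : S) • c H = (x : S) • c G) :
      (x : S) • c (F x) = (x : S) • c G := by
    obtain ⟨H, h1, h2⟩ := exists_ge_ge (F x) G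
    rw [← hF x H h1, hG H h2]
  obtain ⟨m, hm⟩ := hS M hM I
    { toFun := fun x => (x : S) • c (F x)
      map_add' := fun x y => by
        obtain ⟨H, h1, h2⟩ := exists_ge_ge (F x) (F y)
        rw [key (x + y) H, Submodule.coe_add, add_smul, hF x H h1, hF y H h2]
        intro G hG
        rw [Submodule.coe_add, add_smul, add_smul, hF x H h1, hF y H h2,
          hF x G (h1.trans hG), hF y G (h2.trans hG)]
      map_smul' := fun s x => by
        rw [key (s • x) (F x), Submodule.coe_smul, smul_eq_mul, mul_smul, RingHom.id_apply]
        intro G hG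
        rw [Submodule.coe_smul, smul_eq_mul, mul_smul, mul_smul, hF x G hG] }
  refine ⟨m, fun x G hG => ?_⟩
  have := hm ⟨x, G, hG⟩
  exact this.symm.trans (key ⟨x, G, hG⟩ G hG)

/-- Given orthogonal idempotents `p i`, there are elements with prescribed zero-one
coordinates. -/
theorem CyclicExt.exists_indicator (hS : CyclicExt S) {ι : Type*} {p : ι → S}
    (hp : ∀ i, p i * p i = p i) (ho : ∀ i j, i ≠ j → p i * p j = 0) (X : ι → Prop)
    [DecidablePred X] :
    ∃ c : S, (∀ i, p i * c = if X i then p i else 0) ∧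
      ∀ x, (∀ i, x * p i = 0) → x * c = 0 := by
  classical
  have hsum (j : ι) (G : Finset ι) (hG : j ∈ G) :
      p j * ∑ i ∈ G, (if X i then p i else 0) = if X j then p j else 0 := by
    rw [Finset.mul_sum, Finset.sum_eq_single_of_mem j hG]
    · split_ifs
      · exact hp j
      · exact mul_zero _
    · intro i _ hij
      split_ifs
      · exact ho j i hij.symm
      · exact mul_zero _
  obtain ⟨c, hc⟩ := hS.exists_eventual isPrincipal_self
    (fun F : Finset ι => ∑ i ∈ F, if X i then p i else 0)
  refine ⟨c, fun j => ?_, fun x hx => ?_⟩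
  · refine (hc (p j) {j} fun G hG => ?_).trans (hsum j _ (Finset.mem_singleton_self j))
    exact (hsum j G (Finset.singleton_subset_iff.1 hG)).trans
      (hsum j _ (Finset.mem_singleton_self j)).symm
  · have h0 (G : Finset ι) : x * ∑ i ∈ G, (if X i then p i else 0) = 0 := by
      rw [Finset.mul_sum]
      exact Finset.sum_eq_zero fun i _ => by rw [mul_ite, hx, mul_zero, ite_self]
    exact (hc x ∅ fun G _ => (h0 G).trans (h0 ∅).symm).trans (h0 ∅)

/-- The core of Osofsky's theorem: an infinite family of orthogonal idempotents with an essential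
hull yields a homomorphism to a cyclic semimodule that does not extend. -/
theorem CyclicExt.false_of_orthogonal (hS : CyclicExt S) {p : ℕ × ℕ → S} (hp0 : ∀ i, p i ≠ 0)
    (hp : ∀ i, p i * p i = p i) (ho : ∀ i j, i ≠ j → p i * p j = 0) {e : S}
    (hpe : ∀ i, p i * e = p i)
    (he : ∀ x y, (∀ i, p i * x = p i * y) → e * x = e * y) : False := by
  classical
  have hee : e * e = e := by
    rw [he e 1 fun i => by rw [hpe, mul_one], mul_one]
  -- Multiplying by `e` preserves the coordinates `p i * q` and makes them determine the element.
  have hE (X : ℕ × ℕ → Prop) : ∃ q : S, e * q = q ∧ ∀ i, p i * q = if X i then p i else 0 := by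
    obtain ⟨c, hc, -⟩ := hS.exists_indicator hp ho X
    exact ⟨e * c, by rw [← mul_assoc, hee], fun i => by rw [← mul_assoc, hpe, hc]⟩
  have hext {x y : S} (hx : e * x = x) (hy : e * y = y) (h : ∀ i, p i * x = p i * y) : x = y := by
    rw [← hx, ← hy, he x y h]
  choose Q hQe hQp using fun k : ℕ => hE fun i => i.1 = k
  have hQQ (k l : ℕ) : Q k * Q l = if k = l then Q k else 0 := by
    refine hext (by rw [← mul_assoc, hQe]) (by split_ifs <;> simp [hQe]) fun i => ?_
    rw [← mul_assoc, hQp]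
    split_ifs with h1 h2 h2
    · subst h2; rw [hQp]
    · rw [hQp, if_neg (by omega), mul_zero]
    · subst h2; rw [zero_mul, hQp, if_neg h1]
    · rw [zero_mul, mul_zero]
  set J : Submodule S S := Submodule.span S (Set.range p)
  have hpJ (s : S) (i : ℕ × ℕ) : s * p i ∈ J :=
    J.smul_mem s (Submodule.subset_span ⟨i, rfl⟩)
  have hJ (y : S) (hy : y ∈ J) : ∃ F : Finset (ℕ × ℕ), ∀ i ∉ F, y * p i = 0 := by
    induction hy using Submodule.span_induction with
    | mem y hy =>
      obtain ⟨j, rfl⟩ := hy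
      exact ⟨{j}, fun i hi => ho j i fun h => hi (by simp [h])⟩
    | zero => exact ⟨∅, fun i _ => zero_mul _⟩
    | add x y _ _ hx hy =>
      obtain ⟨F, hF⟩ := hx
      obtain ⟨G, hG⟩ := hy
      refine ⟨F ∪ G, fun i hi => ?_⟩
      rw [Finset.mem_union, not_or] at hi
      rw [add_mul, hF i hi.1, hG i hi.2, add_zero]
    | smul s x _ hx =>
      obtain ⟨F, hF⟩ := hx
      exact ⟨F, fun i hi => by rw [smul_eq_mul, mul_assoc, hF i hi, mul_zero]⟩
  -- Modulo `J`, `m` stands for the infinite sum of the row idempotents `Q k`.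
  obtain ⟨m', hm'⟩ := hS.exists_eventual (isPrincipal_quotient (bourneCon J))
    (fun K : ℕ => bourneMk J (∑ k ∈ Finset.range K, Q k))
  obtain ⟨m, rfl⟩ := bourneMk_surjective J m'
  have hmul (x y : S) : x • bourneMk J y = bourneMk J (x * y) := (map_smul _ x y).symm
  simp only [hmul] at hm'
  have hQm (k : ℕ) : bourneMk J (Q k * m) = bourneMk J (Q k) := by
    have hQK (K : ℕ) (hK : k + 1 ≤ K) : Q k * ∑ l ∈ Finset.range K, Q l = Q k := by
      rw [Finset.mul_sum, Finset.sum_eq_single_of_mem k (Finset.mem_range.2 (by omega))]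
      · rw [hQQ, if_pos rfl]
      · intro l _ hl
        rw [hQQ, if_neg hl.symm]
    rw [hm' (Q k) (k + 1) fun G hG => by rw [hQK G hG, hQK _ le_rfl], hQK _ le_rfl]
  -- Each element of `J` kills all but finitely many `p i` on its right, so `Q k * m ≡ Q k` modulo
  -- `J` becomes an equality at some `(k, n)`.
  have hrow (k : ℕ) : ∃ n : ℕ, p (k, n) * m * p (k, n) = p (k, n) := by
    obtain ⟨j, hj, j', hj', h⟩ := (bourneMk_eq_iff J).1 (hQm k)
    obtain ⟨F, hF⟩ := hJ j hj
    obtain ⟨F', hF'⟩ := hJ j' hj'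
    obtain ⟨n, hn⟩ := Infinite.exists_notMem_finset ((F ∪ F').image Prod.snd)
    have hn' : (k, n) ∉ F ∪ F' := fun h => hn (Finset.mem_image_of_mem Prod.snd h)
    rw [Finset.mem_union, not_or] at hn'
    refine ⟨n, ?_⟩
    have h1 := congrArg (fun z => p (k, n) * (z * p (k, n))) h
    simp only [add_mul, hF _ hn'.1, hF' _ hn'.2, add_zero] at h1
    simpa only [← mul_assoc, hQp, if_true, hp] using h1
  choose h hh using hrow
  -- `Z` selects the entry `(k, h k)` of each row. All `Z * Q k` lie in `J`, so `Z * m ≡ 0`; but `Z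
  -- * m` has a nonzero diagonal entry at every `(k, h k)`, which the finiteness property of `J`
  -- forbids.
  obtain ⟨Z, hZe, hZp⟩ := hE fun i => i.2 = h i.1
  have hZQ (k : ℕ) : Z * Q k = e * p (k, h k) := by
    refine hext (by rw [← mul_assoc, hZe]) (by rw [← mul_assoc, hee]) fun i => ?_
    rw [← mul_assoc, hZp, ← mul_assoc, hpe]
    by_cases hi : i = (k, h k)
    · subst hi
      rw [if_pos rfl, hQp, if_pos rfl, hp]
    · rw [ho _ _ hi]
      split_ifs with h1
      · rw [hQp, if_neg]
        rintro rfl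
        exact hi (Prod.ext rfl h1)
      · exact zero_mul _
  have hZ0 (K : ℕ) : bourneMk J (Z * ∑ l ∈ Finset.range K, Q l) = 0 := by
    rw [Finset.mul_sum]
    exact bourneMk_eq_zero (J.sum_mem fun k _ => hZQ k ▸ hpJ e _)
  have hZm := (hm' Z 0 fun G _ => (hZ0 G).trans (hZ0 0).symm).trans (hZ0 0)
  rw [← map_zero (bourneMk J), bourneMk_eq_iff] at hZm
  obtain ⟨j, hj, j', hj', hjj⟩ := hZm
  obtain ⟨F, hF⟩ := hJ j hj
  obtain ⟨F', hF'⟩ := hJ j' hj'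
  obtain ⟨k, hk⟩ := Infinite.exists_notMem_finset ((F ∪ F').image Prod.fst)
  have hk' : (k, h k) ∉ F ∪ F' := fun h => hk (Finset.mem_image_of_mem Prod.fst h)
  rw [Finset.mem_union, not_or] at hk'
  have h1 := congrArg (fun z => p (k, h k) * (z * p (k, h k))) hjj
  simp only [add_mul, hF _ hk'.1, hF' _ hk'.2, add_zero, zero_mul, mul_zero] at h1
  simp only [← mul_assoc, hZp, if_true, hh] at h1
  exact hp0 _ h1

end

/-! ### Osofsky's theorem for rings. -/

section Ring

variable {R : Type u} [Ring R]

/-- Take `K` maximal with `I ∩ K = 0`; `e` extends the projection `I ⊕ K → I`. Then `z = e * (x -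
y)` is killed by `I` and `K`. By regularity `R (z * w)` can be added to `K` without meeting `I`, so
it lies in `K`, whence `z = z * w * z = 0`. -/
theorem CyclicExt.exists_hull (hR : CyclicExt R) {ι : Type*} (p : ι → R) :
    ∃ e, (∀ i, p i * e = p i) ∧ ∀ x y, (∀ i, p i * x = p i * y) → e * x = e * y := by
  set I : Submodule R R := Submodule.span R (Set.range p)
  obtain ⟨K, -, hK⟩ := zorn_le_nonempty₀ {K : Submodule R R | Disjoint I K}
    (fun c hc hch _ _ => ⟨sSup c, (hch.directedOn.disjoint_sSup_right).2 fun K hK => hc hK,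
      fun _ => le_sSup⟩) ⊥ disjoint_bot_right
  have hIK : Disjoint I K := hK.prop
  have hinj : Function.Injective (I.subtype.coprod K.subtype) := by
    rw [← LinearMap.ker_eq_bot, LinearMap.ker_coprod_of_disjoint_range _ _ (by simpa using hIK)]
    simp
  obtain ⟨e, he⟩ := hR R isPrincipal_self _
    (I.subtype ∘ₗ LinearMap.fst R I K ∘ₗ (LinearEquiv.ofInjective _ hinj).symm.toLinearMap)
  have he' (i : I) (k : K) : ((i : R) + k) * e = i := by
    have := he (LinearEquiv.ofInjective _ hinj (i, k))
    simpa using this.symm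
  have heI (x : R) (hx : x ∈ I) : x * e = x := by simpa using he' ⟨x, hx⟩ 0
  have heK (x : R) (hx : x ∈ K) : x * e = 0 := by simpa using he' 0 ⟨x, hx⟩
  have hpI (i : ι) : p i ∈ I := Submodule.subset_span ⟨i, rfl⟩
  refine ⟨e, fun i => heI _ (hpI i), fun x y hxy => ?_⟩
  set z := e * (x - y) with hz
  have hIz (a : R) (ha : a ∈ I) : a * z = 0 := by
    rw [hz, ← mul_assoc, heI a ha]
    induction ha using Submodule.span_induction with
    | mem a ha => obtain ⟨i, rfl⟩ := ha; rw [mul_sub, hxy, sub_self]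
    | zero => exact zero_mul _
    | add a b _ _ ha hb => rw [add_mul, ha, hb, add_zero]
    | smul s a _ ha => rw [smul_eq_mul, mul_assoc, ha, mul_zero]
  have hKz (a : R) (ha : a ∈ K) : a * z = 0 := by
    rw [hz, ← mul_assoc, heK a ha, zero_mul]
  obtain ⟨w, hw⟩ := hR.regular z
  set U : Submodule R R := Submodule.span R {z * w}
  have hUz (a : R) (ha : a ∈ U) (haz : a * z = 0) : a = 0 := by
    obtain ⟨s, rfl⟩ := Submodule.mem_span_singleton.1 ha
    rw [smul_eq_mul, mul_assoc, hw] at haz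
    rw [smul_eq_mul, ← mul_assoc, haz, zero_mul]
  have hUle : U ≤ K := by
    refine le_sup_right.trans (hK.2 (y := K ⊔ U) ?_ le_sup_left)
    refine Submodule.disjoint_def.2 fun a haI haKU => ?_
    obtain ⟨k, hk, u, hu, rfl⟩ := Submodule.mem_sup.1 haKU
    have h0 := hIz _ haI
    rw [add_mul, hKz k hk, zero_add] at h0
    obtain rfl := hUz u hu h0
    rw [add_zero] at haI ⊢
    exact Submodule.disjoint_def.1 hIK k haI hk
  have h0 : z * w * z = 0 := hKz _ (hUle (Submodule.mem_span_singleton_self _))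
  rw [hw, hz, mul_sub, sub_eq_zero] at h0
  exact h0

theorem CyclicExt.exists_eq_zero (hR : CyclicExt R) {p : ℕ → R} (hp : ∀ i, p i * p i = p i)
    (ho : ∀ i j, i ≠ j → p i * p j = 0) : ∃ i, p i = 0 := by
  by_contra! hp0
  obtain ⟨e, hpe, he⟩ := hR.exists_hull fun i : ℕ × ℕ => p (Nat.pairEquiv i)
  exact hR.false_of_orthogonal (fun i => hp0 _) (fun i => hp _)
    (fun i j h => ho _ _ (Nat.pairEquiv.injective.ne h)) hpe he

/-- If every idempotent of a set closed under addition of orthogonal idempotents is enlarged by an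
orthogonal one, there is an infinite orthogonal family. -/
theorem exists_orthogonal_seq {S : Type*} [Semiring S] {P : S → Prop} (h0 : P 0)
    (hadd : ∀ f g, P f → P g → P (f + g))
    (h : ∀ f, P f → f * f = f → ∃ g, P g ∧ g * g = g ∧ g ≠ 0 ∧ f * g = 0 ∧ g * f = 0) :
    ∃ p : ℕ → S, (∀ i, p i * p i = p i) ∧ (∀ i j, i ≠ j → p i * p j = 0) ∧ ∀ i, p i ≠ 0 := by
  choose G hGP hGG hG0 hfG hGf using h
  let next (f : {f : S // P f ∧ f * f = f}) : {f : S // P f ∧ f * f = f} :=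
    ⟨f + G f f.2.1 f.2.2, hadd _ _ f.2.1 (hGP _ _ _), by
      simp only [add_mul, mul_add, hGG, hfG, hGf, f.2.2, add_zero, zero_add]⟩
  let F : ℕ → {f : S // P f ∧ f * f = f} :=
    fun n => next^[n] ⟨0, h0, mul_zero 0⟩
  let g (n : ℕ) : S := G (F n).1 (F n).2.1 (F n).2.2
  have hF (n : ℕ) : (F (n + 1)).1 = (F n).1 + g n :=
    congrArg Subtype.val (Function.iterate_succ_apply' next n _)
  have hgg (n : ℕ) : g n * g n = g n := hGG _ _ _
  have hFg (n : ℕ) : (F n : S) * g n = 0 := hfG _ _ _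
  have hgF (n : ℕ) : g n * F n = 0 := hGf _ _ _
  -- `F n` is the sum of the earlier `g m`, hence acts on each as an identity.
  have key (m n : ℕ) (hmn : m < n) : (F n : S) * g m = g m ∧ g m * F n = g m := by
    induction n, hmn using Nat.le_induction with
    | base => rw [hF, add_mul, mul_add, hFg, hgF, hgg, zero_add]; exact ⟨rfl, rfl⟩
    | succ n hn ih =>
      have h1 : g n * g m = 0 := by rw [← ih.1, ← mul_assoc, hgF, zero_mul]
      have h2 : g m * g n = 0 := by rw [← ih.2, mul_assoc, hFg, mul_zero]
      rw [hF, add_mul, mul_add, ih.1, ih.2, h1, h2, add_zero]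
      exact ⟨rfl, rfl⟩
  refine ⟨g, hgg, fun i j hij => ?_, fun n => hG0 _ _ _⟩
  rcases hij.lt_or_gt with hij | hij
  · rw [← (key i j hij).2, mul_assoc, hFg, mul_zero]
  · rw [← (key j i hij).1, ← mul_assoc, hgF, zero_mul]

/-- Osofsky's theorem: a ring all of whose cyclic modules are injective is semisimple. -/
theorem CyclicExt.isSemisimpleRing (hR : CyclicExt R) : IsSemisimpleRing R := by
  -- Every left ideal has a right unit; otherwise its idempotents could be enlarged forever.
  have key (I : Submodule R R) : ∃ f ∈ I, ∀ x ∈ I, x * f = x := by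
    by_contra! hI
    obtain ⟨p, hp, ho, hp0⟩ := exists_orthogonal_seq (P := (· ∈ I)) I.zero_mem
      (fun f g => I.add_mem) fun f hf hff => by
        obtain ⟨a, ha, haf⟩ := hI f hf
        set b := a - a * f with hb
        have hbI : b ∈ I := I.sub_mem ha (I.smul_mem a hf)
        have hb0 : b ≠ 0 := fun h => haf (sub_eq_zero.1 h).symm
        have hbf : b * f = 0 := by rw [hb, sub_mul, mul_assoc, hff, sub_self]
        obtain ⟨w, hw⟩ := hR.regular b
        set u := w * b with hu
        have huu : u * u = u := by rw [hu, mul_assoc, ← mul_assoc b, hw]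
        have huf : u * f = 0 := by rw [hu, mul_assoc, hbf, mul_zero]
        have huI : u ∈ I := I.smul_mem w hbI
        -- `u` only satisfies `u * f = 0`; subtracting `f * u` makes it orthogonal to `f` on both
        -- sides.
        have hug : u * (u - f * u) = u := by rw [mul_sub, ← mul_assoc u f, huf, zero_mul, sub_zero,
          huu]
        refine ⟨u - f * u, I.sub_mem huI (I.smul_mem f huI), ?_, fun h => hb0 ?_, ?_, ?_⟩
        · rw [sub_mul, mul_assoc f, hug]
        · rw [h, mul_zero] at hug
          rw [← hw, mul_assoc, ← hu, ← hug, mul_zero]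
        · rw [mul_sub, ← mul_assoc f f, hff, sub_self]
        · rw [sub_mul, mul_assoc f, huf, mul_zero, sub_zero]
    obtain ⟨i, hi⟩ := hR.exists_eq_zero hp ho
    exact hp0 i hi
  refine { exists_isCompl := fun I => ?_ }
  obtain ⟨f, hf, hI⟩ := key I
  refine ⟨Submodule.span R {1 - f}, ?_, ?_⟩
  · refine Submodule.disjoint_def.2 fun x hx hx' => ?_
    obtain ⟨s, rfl⟩ := Submodule.mem_span_singleton.1 hx'
    rw [← hI _ hx, smul_eq_mul, mul_assoc, sub_mul, one_mul, hI f hf, sub_self, mul_zero]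
  · refine codisjoint_iff.2 (Submodule.eq_top_iff'.2 fun x => Submodule.mem_sup.2
      ⟨x * f, I.smul_mem x hf, x * (1 - f),
        Submodule.smul_mem _ x (Submodule.mem_span_singleton_self _), ?_⟩)
    rw [mul_sub, mul_one, add_sub_cancel]

end Ring

/-! ### The Boolean factor. -/

section Boolean

/-- An infinite descending chain has disjoint nonzero differences, so the algebra is atomic; its
atoms are finitely many, and each element is determined by the atoms below it. -/
theorem finite_of_disjoint {B : Type*} [BooleanAlgebra B]
    (h : ∀ p : ℕ → B, (∀ i j, i ≠ j → p i ⊓ p j = ⊥) → ∃ i, p i = ⊥) : Finite B := by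
  have hwf : WellFoundedLT B := by
    refine ⟨RelEmbedding.wellFounded_iff_isEmpty.2 ⟨fun a => ?_⟩⟩
    have ha : StrictAnti a := fun i j hij => a.map_rel_iff.2 hij
    obtain ⟨i, hi⟩ := h (fun n => a n \ a (n + 1)) fun i j hij => by
      rw [← disjoint_iff]
      rcases hij.lt_or_gt with hij | hij
      · exact disjoint_sdiff_self_left.mono_right (sdiff_le.trans (ha.antitone hij))
      · exact (disjoint_sdiff_self_left.mono_right (sdiff_le.trans (ha.antitone hij))).symm
    exact (ha (Nat.lt_succ_self i)).not_ge (sdiff_eq_bot_iff.1 hi)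
  have hat : IsAtomic B := isAtomic_of_orderBot_wellFounded_lt hwf.wf
  have hfin : Finite {a : B // IsAtom a} := by
    by_contra hinf
    rw [not_finite_iff_infinite] at hinf
    let a := Infinite.natEmbedding {a : B // IsAtom a}
    obtain ⟨i, hi⟩ := h (fun n => (a n : B)) fun i j hij =>
      disjoint_iff.1 ((a i).2.disjoint_of_ne (a j).2 fun h => hij (a.injective (Subtype.ext h)))
    exact (a i).2.1 hi
  have hle (x y : B) (hxy : ∀ a, IsAtom a → a ≤ x → a ≤ y) : x ≤ y := by
    rcases hat.eq_bot_or_exists_atom_le (x \ y) with h0 | ⟨a, ha, hax⟩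
    · exact sdiff_eq_bot_iff.1 h0
    · exact absurd (le_bot_iff.1 (disjoint_sdiff_self_left hax
        (hxy a ha (hax.trans sdiff_le)))) ha.1
  refine Finite.of_injective (fun x : B => {a : {a : B // IsAtom a} | (a : B) ≤ x})
    fun x y hxy => ?_
  refine le_antisymm (hle x y fun a ha hax => ?_) (hle y x fun a ha hax => ?_)
  · exact (Set.ext_iff.1 hxy ⟨a, ha⟩).1 hax
  · exact (Set.ext_iff.1 hxy ⟨a, ha⟩).2 hax

variable {T : Type u} [Semiring T]

/-- A semiring whose largest element is `1`, with idempotent commuting complemented elements, is a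
Boolean algebra. -/
theorem isBooleanAlgebra_of_complement (h1 : ∀ x : T, x + 1 = 1) (hi : ∀ x : T, x * x = x)
    (hc : ∀ x y : T, x * y = y * x) (hcompl : ∀ x : T, ∃ y, x + y = 1 ∧ x * y = 0) :
    IsBooleanAlgebra T := by
  have hmul (x y : T) : x * y + x = x := by
    nth_rewrite 2 [← mul_one x]
    rw [← mul_add, h1, mul_one]
  have hadd (x : T) : x + x = x := by
    nth_rewrite 1 [← mul_one x]
    exact hmul x 1
  have hle (x y : T) (h : x + y = y) : x * y = x := by rw [← h, mul_add, hi, add_comm, hmul]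
  choose compl h2 h3 using hcompl
  refine ⟨
    { le := fun x y => x + y = y
      le_refl := hadd
      le_trans := fun x y z (h : x + y = y) (h' : y + z = z) => show x + z = z by
        rw [← h', ← add_assoc, h]
      le_antisymm := fun x y (h : x + y = y) (h' : y + x = x) => by rw [← h, add_comm, h']
      sup := fun x y => x + y
      inf := fun x y => x * y
      le_sup_left := fun x y => show x + (x + y) = x + y by rw [← add_assoc, hadd]
      le_sup_right := fun x y => show y + (x + y) = x + y by rw [add_left_comm, hadd]
      sup_le := fun x y z (h : x + z = z) (h' : y + z = z) => show x + y + z = z by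
        rw [add_assoc, h', h]
      inf_le_left := hmul
      inf_le_right := fun x y => show x * y + y = y by rw [hc, hmul]
      le_inf := fun x y z (h : x + y = y) (h' : x + z = z) => show x + y * z = y * z by
        have hx : x * (y * z) = x := by rw [← mul_assoc, hle x y h, hle x z h']
        nth_rewrite 1 [← hx]
        rw [hc, hmul]
      le_sup_inf := fun x y z => show (x + y) * (x + z) + (x + y * z) = x + y * z by
        have hx : (x + y) * (x + z) = x + y * z := by
          rw [add_mul, mul_add, mul_add, hi, hc y x, add_comm x (x * z), hmul, ← add_assoc,
            add_comm x (x * y), hmul]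
        rw [hx, hadd]
      compl := compl
      top := 1
      bot := 0
      inf_compl_le_bot := fun x => show x * compl x + 0 = 0 by rw [h3, add_zero]
      top_le_sup_compl := fun x => show 1 + (x + compl x) = x + compl x by rw [h2, hadd]
      le_top := h1
      bot_le := zero_add }, fun _ _ => rfl, fun _ _ => rfl, rfl, rfl⟩

theorem CyclicExt.isBooleanAlgebra (hT : CyclicExt T) (h1 : ∀ x : T, x + 1 = 1)
    (hcompl : ∀ f : T, f * f = f → ∃ a b : T, 1 + a = f + b ∧ f * a = 0 ∧ f * b = 0) :
    IsBooleanAlgebra T ∧ Finite T := by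
  have hmul (x y : T) : x * y + x = x := by
    nth_rewrite 2 [← mul_one x]
    rw [← mul_add, h1, mul_one]
  have hmul' (x y : T) : x * y + y = y := by
    nth_rewrite 2 [← one_mul y]
    rw [← add_mul, h1, one_mul]
  have hi (x : T) : x * x = x := by
    obtain ⟨b, hb⟩ := hT.regular x
    have h : x + x * x = x * x := by
      nth_rewrite 1 [← hb]
      nth_rewrite 3 [← mul_one x]
      rw [← add_mul, ← mul_add, h1, mul_one]
    rw [← h, add_comm, hmul]
  -- Idempotence gives `xy = x(yx)y`, which is below `yx` because every factor is below `1`.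
  have hle (x y : T) : x * y + y * x = y * x := by
    have hxy : x * (y * x) * y = x * y := by rw [← mul_assoc, mul_assoc, hi]
    calc x * y + y * x = x * (y * x) * y + (x * (y * x) + y * x) := by rw [hxy, hmul']
      _ = y * x := by rw [← add_assoc, hmul, hmul']
  have hc (x y : T) : x * y = y * x := by
    rw [← hle x y, add_comm, hle y x]
  have hc' (x : T) : ∃ y, x + y = 1 ∧ x * y = 0 := by
    obtain ⟨a, b, h, -, hb⟩ := hcompl x (hi x)
    exact ⟨b, by rw [← h, add_comm, h1], hb⟩
  have hB := isBooleanAlgebra_of_complement h1 hi hc hc'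
  refine ⟨hB, ?_⟩
  obtain ⟨_, hsup, hinf, hbot, htop⟩ := hB
  refine finite_of_disjoint fun p hp => ?_
  by_contra! hp0
  have ho (i j : ℕ) (hij : i ≠ j) : p i * p j = 0 := by rw [hinf, hp i j hij, hbot]
  have ho' (i j : ℕ × ℕ) (hij : i ≠ j) : p (Nat.pairEquiv i) * p (Nat.pairEquiv j) = 0 :=
    ho _ _ (Nat.pairEquiv.injective.ne hij)
  obtain ⟨e, hpe, he⟩ := hT.exists_indicator (fun i : ℕ × ℕ => hi (p (Nat.pairEquiv i))) ho'
    fun _ => True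
  simp only [if_true] at hpe
  refine hT.false_of_orthogonal (fun i => hbot ▸ hp0 _) (fun i => hi _) ho' hpe fun x y hxy => ?_
  -- With `z` the complement of `y`, `x * z` is killed by all `p i`, hence by `e`. So complements
  -- replace subtraction in showing that `e` is a hull.
  have key (x y : T) (hxy : ∀ i : ℕ × ℕ, p (Nat.pairEquiv i) * x = p (Nat.pairEquiv i) * y) :
      e * x = e * x * y := by
    obtain ⟨z, hz1, hz0⟩ := hc' y
    have h0 : x * z * e = 0 := he _ fun i => by
      rw [hc, ← mul_assoc, hxy, mul_assoc, hz0, mul_zero]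
    calc e * x = e * x * (y + z) := by rw [hz1, mul_one]
      _ = e * x * y := by rw [mul_add, mul_assoc e x z, hc e (x * z), h0, add_zero]
  rw [key x y hxy, key y x fun i => (hxy i).symm, mul_assoc, mul_assoc, hc x y]

end Boolean

/-! ### Splitting off the ring of additively invertible elements. -/

/-- The left ideal of additively invertible elements. -/
def invertibles (S : Type u) [Semiring S] : Submodule S S where
  carrier := {x | ∃ y, x + y = 0}
  zero_mem' := ⟨0, add_zero 0⟩
  add_mem' := by
    rintro x y ⟨x', hx⟩ ⟨y', hy⟩
    exact ⟨x' + y', by rw [add_add_add_comm, hx, hy, add_zero]⟩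
  smul_mem' := by
    rintro s x ⟨y, hy⟩
    exact ⟨s * y, by rw [smul_eq_mul, ← mul_add, hy, mul_zero]⟩

variable {S : Type u} [Semiring S]

theorem mul_mem_invertibles {x : S} (hx : x ∈ invertibles S) (s : S) : x * s ∈ invertibles S := by
  obtain ⟨y, hy⟩ := hx
  exact ⟨y * s, by rw [← add_mul, hy, zero_mul]⟩

theorem eq_zero_of_mem_invertibles {x : S} (hx : x ∈ invertibles S) (h : x + x = x) : x = 0 := by
  obtain ⟨y, hy⟩ := hx
  rw [← hy]
  nth_rewrite 2 [← h]
  rw [add_assoc, hy, add_zero]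

/-- The congruence on `S × S` making `(0, y)` absorb the elements `(p, 0)` with `p` below some
multiple `y * s`. -/
def absorbCon (S : Type u) [Semiring S] : ModuleCon S (S × S) where
  r a b := a.2 = b.2 ∧ ∃ p q, (∃ z s, p + z = a.2 * s) ∧ (∃ z s, q + z = a.2 * s) ∧
    a.1 + p = b.1 + q
  iseqv :=
    { refl := fun a => ⟨rfl, 0, 0, ⟨0, 0, by simp⟩, ⟨0, 0, by simp⟩, rfl⟩
      symm := fun ⟨h, p, q, hp, hq, e⟩ => ⟨h.symm, q, p, h ▸ hq, h ▸ hp, e.symm⟩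
      trans := by
        rintro a b c ⟨h, p, q, ⟨z, s, hp⟩, ⟨w, t, hq⟩, e⟩
          ⟨h', p', q', ⟨z', s', hp'⟩, ⟨w', t', hq'⟩, e'⟩
        refine ⟨h.trans h', p + p', q' + q, ⟨z + z', s + s', ?_⟩, ⟨w' + w, t' + t, ?_⟩, ?_⟩
        · rw [add_add_add_comm, hp, hp', mul_add, h]
        · rw [add_add_add_comm, hq, hq', mul_add, h]
        · rw [← add_assoc, e, add_right_comm, e', add_assoc] }
  add' := by
    rintro a b c d ⟨h, p, q, ⟨z, s, hp⟩, ⟨w, t, hq⟩, e⟩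
      ⟨h', p', q', ⟨z', s', hp'⟩, ⟨w', t', hq'⟩, e'⟩
    refine ⟨congrArg₂ (· + ·) h h', p + p', q + q',
      ⟨z + z' + (a.2 * s' + c.2 * s), s + s', ?_⟩, ⟨w + w' + (a.2 * t' + c.2 * t), t + t', ?_⟩,
      ?_⟩
    · change p + p' + _ = (a.2 + c.2) * (s + s')
      rw [add_mul, mul_add, mul_add, ← hp, ← hp']
      abel
    · change q + q' + _ = (a.2 + c.2) * (t + t')
      rw [add_mul, mul_add, mul_add, ← hq, ← hq']
      abel
    · change a.1 + c.1 + _ = b.1 + d.1 + _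
      rw [add_add_add_comm, e, e', add_add_add_comm]
  smul := by
    rintro r a b ⟨h, p, q, ⟨z, s, hp⟩, ⟨w, t, hq⟩, e⟩
    refine ⟨congrArg (r * ·) h, r * p, r * q, ⟨r * z, s, ?_⟩, ⟨r * w, t, ?_⟩, ?_⟩
    · change _ = r * a.2 * s
      rw [← mul_add, hp, mul_assoc]
    · change _ = r * a.2 * t
      rw [← mul_add, hq, mul_assoc]
    · change r * a.1 + _ = r * b.1 + _
      rw [← mul_add, e, mul_add]

/-- Some element is the largest one modulo additively invertible elements. -/
theorem exists_absorbing (h : EInjective S (bourneCon (invertibles S)).Quotient) :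
    ∃ t : S, ∀ x, ∃ p ∈ invertibles S, ∃ q ∈ invertibles S, x + t + p = t + q := by
  let B := (absorbCon S).Quotient
  -- Over second coordinate `0` only additively invertible elements are absorbed, so `x ↦ (x, 0)`
  -- embeds the quotient by them.
  have hdom (p : S) (hp : ∃ z s, p + z = (0 : S) * s) : p ∈ invertibles S := by
    obtain ⟨z, s, e⟩ := hp
    exact ⟨z, by rw [e, zero_mul]⟩
  let f : (bourneCon (invertibles S)).Quotient →ₗ[S] B :=
    conLift _ (conMk (absorbCon S) ∘ₗ LinearMap.inl S S S) (by
      rintro x y ⟨a, ⟨a', ha⟩, b, ⟨b', hb⟩, e⟩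
      exact (conMk_eq_iff _).2 ⟨rfl, a, b, ⟨a', 0, by simpa using ha⟩, ⟨b', 0, by simpa using hb⟩,
        e⟩)
  have hf (x : S) : f (bourneMk _ x) = conMk (absorbCon S) (x, 0) := rfl
  let g : B →ₗ[S] S := conLift _ (LinearMap.snd S S S) fun x y hxy => hxy.1
  have hg (a : S × S) : g (conMk _ a) = a.2 := rfl
  have hfg : IsShortExact f g := by
    refine ⟨.of_injective (fun x y e => ?_) fun b => ⟨fun hb => ?_, ?_⟩,
      .of_surjective (fun y => ⟨conMk _ (0, y), rfl⟩) (LinearMap.ext fun x => ?_)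
        fun b b' e => ?_⟩
    · obtain ⟨x, rfl⟩ := bourneMk_surjective _ x
      obtain ⟨y, rfl⟩ := bourneMk_surjective _ y
      rw [hf, hf, conMk_eq_iff] at e
      obtain ⟨-, p, q, hp, hq, e⟩ := e
      exact (bourneMk_eq_iff _).2 ⟨p, hdom p hp, q, hdom q hq, e⟩
    · obtain ⟨⟨x, y⟩, rfl⟩ := conMk_surjective _ b
      obtain rfl : y = 0 := hb
      exact ⟨bourneMk _ x, rfl⟩
    · rintro ⟨x, rfl⟩
      obtain ⟨x, rfl⟩ := bourneMk_surjective _ x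
      rfl
    · obtain ⟨x, rfl⟩ := bourneMk_surjective _ x
      rfl
    · obtain ⟨⟨x, y⟩, rfl⟩ := conMk_surjective _ b
      obtain ⟨⟨x', y'⟩, rfl⟩ := conMk_surjective _ b'
      obtain rfl : y = y' := e
      refine ⟨bourneMk _ x', bourneMk _ x, ?_⟩
      rw [hf, hf, ← map_add, ← map_add]
      refine congrArg _ (Prod.ext ?_ rfl)
      exact add_comm x x'
  -- `ψ` is a retraction of `f`. Since `(x, 0) + (0, 1) ~ (0, 1)`, the value at `(0, 1)` absorbs
  -- every class.
  obtain ⟨ψ, hψ⟩ := h.exists_extension hfg LinearMap.id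
  obtain ⟨t, ht⟩ := bourneMk_surjective (invertibles S) (ψ (conMk _ (0, 1)))
  refine ⟨t, fun x => (bourneMk_eq_iff _).1 ?_⟩
  have hx : ψ (conMk _ (x, 0)) = bourneMk _ x := LinearMap.congr_fun hψ (bourneMk _ x)
  rw [map_add, ht, ← hx, ← map_add, ← map_add]
  refine congrArg ψ ((conMk_eq_iff _).2 ⟨by simp, 0, x, ⟨1, 1, by simp⟩, ⟨0, x, by simp⟩,
    by simp⟩)

theorem exists_splitting (hS : IsLeftSubtractive S)
    (h : EInjective S (bourneCon (invertibles S)).Quotient) :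
    ∃ v ∈ invertibles S, ∃ i : S, v + i = 1 ∧ i + i = i ∧
      ∀ x, ∃ w ∈ invertibles S, x + 1 = 1 + w := by
  obtain ⟨t, ht⟩ := exists_absorbing h
  have h1 : (1 : S) ∈ invertibles S ⊔ Submodule.span S {t} := by
    obtain ⟨p, hp, q, hq, e⟩ := ht 1
    have htI : t ∈ invertibles S ⊔ Submodule.span S {t} :=
      Submodule.mem_sup_right (Submodule.mem_span_singleton_self t)
    refine hS _ (t + p) 1 (add_mem htI (Submodule.mem_sup_left hp)) ?_
    rw [add_right_comm, add_comm t, e]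
    exact add_mem htI (Submodule.mem_sup_left hq)
  obtain ⟨v, hv, y, hy, hvb⟩ := Submodule.mem_sup.1 h1
  obtain ⟨b, rfl⟩ := Submodule.mem_span_singleton.1 hy
  rw [smul_eq_mul] at hvb
  have htop (x : S) : ∃ w ∈ invertibles S, x + 1 = 1 + w := by
    -- Applied to `t * x` because left multiplication by `b` then produces `b * t * x`, which is `x`
    -- up to `v * x`.
    obtain ⟨p, hp, q, hq, e⟩ := ht (t * x)
    obtain ⟨p', hp'⟩ := (invertibles S).smul_mem b hp
    have hp'V : p' ∈ invertibles S := ⟨_, (add_comm _ _).trans hp'⟩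
    rw [smul_eq_mul] at hp'
    refine ⟨b * q + v * x + p', add_mem (add_mem ((invertibles S).smul_mem b hq)
      (mul_mem_invertibles hv x)) hp'V, ?_⟩
    have e' := congrArg (fun z => b * z) e
    simp only [mul_add, ← mul_assoc] at e'
    calc x + 1 = (v + b * t) * x + (v + b * t) + (b * p + p') := by rw [hvb, hp']; simp
      _ = (b * t * x + b * t + b * p) + v + v * x + p' := by rw [add_mul]; abel
      _ = (v + b * t) + (b * q + v * x + p') := by rw [e']; abel
      _ = _ := by rw [hvb]
  -- From `1 + 1 = 1 + w`, the element `1 + w'`, that is `1 - w`, is additively idempotent.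
  obtain ⟨w, ⟨w', hw⟩, e⟩ := htop 1
  refine ⟨w, ⟨w', hw⟩, 1 + w', ?_, ?_, htop⟩
  · rw [add_left_comm, hw, add_zero]
  · rw [add_add_add_comm, e, add_add_add_comm, hw, add_zero]

/-- The decomposition of a semiring given by two complementary central idempotents. -/
def cornerEquiv {v i : S} (hv : IsIdempotentElem v) (hi : IsIdempotentElem i) (h : v + i = 1)
    (hvi : v * i = 0) (hcv : ∀ x, v * x = x * v) (hci : ∀ x, i * x = x * i) :
    S ≃+* hv.Corner × hi.Corner where
  toFun x := (⟨v * x * v, x, rfl⟩, ⟨i * x * i, x, rfl⟩)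
  invFun a := a.1.1 + a.2.1
  left_inv x := by
    change v * x * v + i * x * i = x
    rw [mul_assoc, ← hcv x, ← mul_assoc, hv.eq, mul_assoc, ← hci x, ← mul_assoc, hi.eq, ← add_mul,
      h, one_mul]
  right_inv := by
    rintro ⟨⟨a, ha⟩, ⟨b, hb⟩⟩
    obtain ⟨ha1, ha2⟩ := (Subsemigroup.mem_corner_iff hv).1 ha
    obtain ⟨hb1, hb2⟩ := (Subsemigroup.mem_corner_iff hi).1 hb
    have hiv : i * v = 0 := by rw [← hcv, hvi]
    refine Prod.ext (Subtype.ext ?_) (Subtype.ext ?_)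
    · change v * (a + b) * v = a
      rw [mul_add, ha1, ← hb1, ← mul_assoc, hvi, zero_mul, add_zero, ha2]
    · change i * (a + b) * i = b
      rw [mul_add, hb1, ← ha1, ← mul_assoc, hiv, zero_mul, zero_add, hb2]
  map_add' x y := by
    refine Prod.ext (Subtype.ext ?_) (Subtype.ext ?_)
    · change v * (x + y) * v = v * x * v + v * y * v
      rw [mul_add, add_mul]
    · change i * (x + y) * i = i * x * i + i * y * i
      rw [mul_add, add_mul]
  map_mul' x y := by
    have hmul {e : S} (he : IsIdempotentElem e) (hc : ∀ x, e * x = x * e) :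
        e * (x * y) * e = e * x * e * (e * y * e) := by
      have hex (x : S) : e * x * e = e * x := by rw [mul_assoc, ← hc, ← mul_assoc, he.eq]
      rw [hex, hex, hex, ← mul_assoc, ← mul_assoc, hex]
    refine Prod.ext (Subtype.ext ?_) (Subtype.ext ?_)
    · change v * (x * y) * v = v * x * v * (v * y * v)
      exact hmul hv hcv
    · change i * (x * y) * i = i * x * i * (i * y * i)
      exact hmul hi hci

/-- A semiring in which `1` has an additive inverse is a ring. -/
abbrev ringOfNeg (R : Type u) [inst : Semiring R] (n : R) (hn : n + 1 = 0) : Ring R :=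
  { inst with
    neg := fun x => n * x
    zsmul := @zsmulRec R _ _ ⟨fun x => n * x⟩ (· • ·)
    zsmul_zero' := fun a => zero_nsmul a
    zsmul_succ' := fun k a => succ_nsmul a k
    zsmul_neg' := fun _ _ => rfl
    neg_add_cancel := fun x => show n * x + x = 0 by
      nth_rewrite 2 [← one_mul x]
      rw [← add_mul, hn, zero_mul] }

theorem exists_ringEquiv_of_eInjective (hS : IsLeftSubtractive S)
    (h : ∀ (M : Type u) [AddCommMonoid M] [Module S M],
      Module.IsPrincipal S M → EInjective S M) :
    ∃ (R T : Type u) (_ : Ring R) (_ : Semiring T),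
      IsSemisimpleRing R ∧ IsBooleanAlgebra T ∧ Finite T ∧ Nonempty (S ≃+* R × T) := by
  obtain ⟨v, hvV, i, hvi1, hii, htop⟩ := exists_splitting hS (h _ (isPrincipal_quotient _))
  -- Products of `i` with invertibles are both additively invertible and additively idempotent,
  -- hence zero. This makes `v` and `i` orthogonal central idempotents.
  have hV0 (x y : S) (hx : x ∈ invertibles S) : x * (i * y) = 0 :=
    eq_zero_of_mem_invertibles (mul_mem_invertibles hx _) (by rw [← mul_add, ← add_mul, hii])
  have hV0' (x y : S) (hx : x ∈ invertibles S) : y * i * x = 0 :=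
    eq_zero_of_mem_invertibles ((invertibles S).smul_mem _ hx)
      (by rw [← add_mul, ← mul_add, hii])
  have hvi : v * i = 0 := by simpa using hV0 v 1 hvV
  have hiv : i * v = 0 := by simpa using hV0' v 1 hvV
  have hv : IsIdempotentElem v := by
    have := congrArg (v * ·) hvi1
    rwa [mul_add, hvi, add_zero, mul_one] at this
  have hi : IsIdempotentElem i := by
    have := congrArg (i * ·) hvi1
    rwa [mul_add, hiv, zero_add, mul_one] at this
  have hcv (x : S) : v * x = x * v := by
    have h1 : v * x * i = 0 := by simpa using hV0 (v * x) 1 (mul_mem_invertibles hvV x)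
    have h2 : i * (x * v) = 0 := by simpa using hV0' (x * v) 1 ((invertibles S).smul_mem x hvV)
    calc v * x = v * x * v + v * x * i := by rw [← mul_add, hvi1, mul_one]
      _ = v * (x * v) + i * (x * v) := by rw [h1, h2, mul_assoc]
      _ = x * v := by rw [← add_mul, hvi1, one_mul]
  have hci (x : S) : i * x = x * i := by
    have h1 : v * x * i = 0 := by simpa using hV0 (v * x) 1 (mul_mem_invertibles hvV x)
    have h2 : i * (x * v) = 0 := by simpa using hV0' (x * v) 1 ((invertibles S).smul_mem x hvV)
    calc i * x = i * (x * v) + i * x * i := by rw [← mul_assoc, ← mul_add, hvi1, mul_one]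
      _ = v * x * i + i * x * i := by rw [h1, h2]
      _ = x * i := by rw [← add_mul, ← add_mul, hvi1, one_mul]
  let E := cornerEquiv hv hi hvi1 hvi hcv hci
  have hext : CyclicExt S := cyclicExt_of_eInjective hS h
  have hextR : CyclicExt hv.Corner :=
    hext.of_surjective ((RingHom.fst _ _).comp E.toRingHom) (Prod.fst_surjective.comp E.surjective)
  have hextT : CyclicExt hi.Corner :=
    hext.of_surjective ((RingHom.snd _ _).comp E.toRingHom) (Prod.snd_surjective.comp E.surjective)
  obtain ⟨n, hn⟩ := hvV
  have hn' : (E n).1 + 1 = 0 := by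
    refine Subtype.ext ?_
    change v * n * v + v = 0
    nth_rewrite 3 [← hv.eq]
    nth_rewrite 3 [← hv.eq]
    rw [← add_mul, ← mul_add, add_comm, hn, mul_zero, zero_mul]
  let _ : Ring hv.Corner := ringOfNeg hv.Corner (E n).1 hn'
  obtain ⟨hT1, hT2⟩ := hextT.isBooleanAlgebra (fun x => by
      obtain ⟨x, hx⟩ := x
      refine Subtype.ext ?_
      change x + i = i
      obtain ⟨w, hw, e⟩ := htop x
      have hix := ((Subsemigroup.mem_corner_iff hi).1 hx).1
      have := congrArg (i * ·) e
      have hiw : i * w = 0 := by simpa using hV0' w 1 hw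
      simpa [mul_add, hix, hiw] using this)
    fun f hf => by
      obtain ⟨a, b, e, ha, hb⟩ := exists_complement_of_eInjective hS (h S isPrincipal_self)
        (f := f.1) (congrArg Subtype.val hf)
      have hEf : (E f.1).2 = f := by
        obtain ⟨h1, h2⟩ := (Subsemigroup.mem_corner_iff hi).1 f.2
        refine Subtype.ext ?_
        change i * f.1 * i = f.1
        rw [h1, h2]
      refine ⟨(E a).2, (E b).2, ?_, ?_, ?_⟩
      · simpa [hEf] using congrArg (fun x => (E x).2) e
      · simpa [hEf] using congrArg (fun x => (E x).2) ha
      · simpa [hEf] using congrArg (fun x => (E x).2) hb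
  exact ⟨hv.Corner, hi.Corner, inferInstance, inferInstance, hextR.isSemisimpleRing, hT1, hT2, ⟨E⟩⟩

/-! ### Checking e-injectivity summand by summand of `1`. -/

section Components

variable {S : Type u} [Semiring S] (M : Type u) [AddCommMonoid M] [Module S M]

/-- Homomorphisms to `M` extend from subtractive subsemimodules after multiplication by `c`. -/
def HasExtension (c : S) : Prop :=
  ∀ (A B : Type u) [AddCommMonoid A] [AddCommMonoid B] [Module S A] [Module S B]
    (f : A →ₗ[S] B), Function.Injective f → IsSubtractive (LinearMap.range f) →
    ∀ φ : A →ₗ[S] M, ∃ ψ : B →ₗ[S] M, ∀ a, ψ (f a) = c • φ a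

/-- Homomorphisms to `M` agreeing on a subtractive subsemimodule agree, after multiplication by `c`,
up to homomorphisms vanishing there. -/
def HasDifference (c : S) : Prop :=
  ∀ (A B : Type u) [AddCommMonoid A] [AddCommMonoid B] [Module S A] [Module S B]
    (f : A →ₗ[S] B), IsSubtractive (LinearMap.range f) →
    ∀ φ ψ : B →ₗ[S] M, (∀ a, φ (f a) = ψ (f a)) →
      ∃ α β : B →ₗ[S] M, (∀ a, α (f a) = 0) ∧ (∀ a, β (f a) = 0) ∧
        ∀ b, c • φ b + α b = c • ψ b + β b

variable {M}

theorem HasExtension.zero : HasExtension M (0 : S) :=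
  fun A B _ _ _ _ f _ _ φ => ⟨0, fun a => by simp⟩

theorem HasExtension.add {c d : S} (hc : HasExtension M c) (hd : HasExtension M d) :
    HasExtension M (c + d) := by
  intro A B _ _ _ _ f hf hf' φ
  obtain ⟨ψ, h⟩ := hc A B f hf hf' φ
  obtain ⟨ψ', h'⟩ := hd A B f hf hf' φ
  exact ⟨ψ + ψ', fun a => by rw [LinearMap.add_apply, h, h', add_smul]⟩

theorem HasDifference.zero : HasDifference M (0 : S) :=
  fun A B _ _ _ _ f _ φ ψ _ => ⟨0, 0, by simp, by simp, by simp⟩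

theorem HasDifference.add {c d : S} (hc : HasDifference M c) (hd : HasDifference M d) :
    HasDifference M (c + d) := by
  intro A B _ _ _ _ f hf φ ψ e
  obtain ⟨α, β, h1, h2, h⟩ := hc A B f hf φ ψ e
  obtain ⟨α', β', h1', h2', h'⟩ := hd A B f hf φ ψ e
  refine ⟨α + α', β + β', fun a => ?_, fun a => ?_, fun b => ?_⟩
  · rw [LinearMap.add_apply, h1, h1', add_zero]
  · rw [LinearMap.add_apply, h2, h2', add_zero]
  · rw [LinearMap.add_apply, LinearMap.add_apply, add_smul, add_smul, add_add_add_comm, h, h',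
      add_add_add_comm]

theorem EInjective.of_hasExtension_one (h : HasExtension M (1 : S))
    (h' : HasDifference M (1 : S)) : EInjective S M := by
  refine .of_extension (fun A B _ _ _ _ f hf hf' φ => ?_) fun A B _ _ _ _ f hf' φ ψ e => ?_
  · obtain ⟨ψ, hψ⟩ := h A B f hf hf' φ
    exact ⟨ψ, LinearMap.ext fun a => by rw [LinearMap.comp_apply, hψ, one_smul]⟩
  · obtain ⟨α, β, h1, h2, h3⟩ := h' A B f hf' φ ψ fun a => LinearMap.congr_fun e a
    refine ⟨α, β, LinearMap.ext h1, LinearMap.ext h2, LinearMap.ext fun b => ?_⟩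
    simpa using h3 b

end Components

/-! ### The ring summand. -/

section Ring

variable {S : Type u} [Semiring S] {R : Type u} [Ring R]

/-- The part of a semimodule on which the ring `R` acts unitally through `ρ`. -/
def unitalPart (ρ : R →ₙ+* S) (B : Type u) [AddCommMonoid B] [Module S B] : AddSubmonoid B where
  carrier := {b | ρ 1 • b = b}
  zero_mem' := smul_zero _
  add_mem' := fun {x y} (hx : _ = _) (hy : _ = _) => show _ = _ by rw [smul_add, hx, hy]

theorem smul_mem_unitalPart (ρ : R →ₙ+* S) {B : Type u} [AddCommMonoid B] [Module S B] (r : R)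
    (b : B) : ρ r • b ∈ unitalPart ρ B := by
  change _ = _
  rw [← mul_smul, ← map_mul, one_mul]

instance (ρ : R →ₙ+* S) (B : Type u) [AddCommMonoid B] [Module S B] :
    Module R (unitalPart ρ B) where
  smul r b := ⟨ρ r • (b : B), smul_mem_unitalPart ρ r (b : B)⟩
  one_smul b := Subtype.ext b.2
  mul_smul r s b := Subtype.ext (by
    change ρ (r * s) • (b : B) = ρ r • ρ s • (b : B)
    rw [map_mul, mul_smul])
  smul_zero r := Subtype.ext (smul_zero _)
  smul_add r b b' := Subtype.ext (smul_add _ _ _)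
  add_smul r s b := Subtype.ext (by
    change ρ (r + s) • (b : B) = ρ r • (b : B) + ρ s • (b : B)
    rw [map_add, add_smul])
  zero_smul b := Subtype.ext (by
    change ρ 0 • (b : B) = 0
    rw [map_zero, zero_smul])

theorem coe_smul_unitalPart (ρ : R →ₙ+* S) {B : Type u} [AddCommMonoid B] [Module S B] (r : R)
    (b : unitalPart ρ B) : ((r • b : unitalPart ρ B) : B) = ρ r • (b : B) := rfl

/-- The restriction of a homomorphism to the unital parts. -/
def unitalPartMap (ρ : R →ₙ+* S) {A B : Type u} [AddCommMonoid A] [Module S A] [AddCommMonoid B]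
    [Module S B] (f : A →ₗ[S] B) : unitalPart ρ A →ₗ[R] unitalPart ρ B where
  toFun a := ⟨f (a : A), by
    change ρ 1 • f (a : A) = f (a : A)
    rw [← map_smul f]
    exact congrArg f a.2⟩
  map_add' a a' := Subtype.ext (map_add f (a : A) (a' : A))
  map_smul' r a := Subtype.ext (by
    change f (ρ r • (a : A)) = ρ r • f (a : A)
    exact map_smul f _ _)

/-- The unital part is a module over a semisimple ring, where extensions exist; `ρ 1` projects onto
it, and `hρ` makes the extension `S`-linear. -/
theorem hasExtension_of_isSemisimpleRing [IsSemisimpleRing R] (ρ : R →ₙ+* S)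
    (hρ : ∀ s, ∃ r, ρ 1 * s = ρ r ∧ s * ρ 1 = ρ r) (M : Type u) [AddCommMonoid M] [Module S M] :
    HasExtension M (ρ 1) := by
  intro A B _ _ _ _ f hf _ φ
  let _ : AddCommGroup (unitalPart ρ A) := Module.addCommMonoidToAddCommGroup R
  let _ : AddCommGroup (unitalPart ρ B) := Module.addCommMonoidToAddCommGroup R
  let _ : AddCommGroup (unitalPart ρ M) := Module.addCommMonoidToAddCommGroup R
  obtain ⟨h, hh⟩ := IsSemisimpleModule.extension_property (unitalPartMap ρ f)
    (fun a a' e => Subtype.ext (hf (congrArg Subtype.val e))) (unitalPartMap ρ φ)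
  refine ⟨⟨⟨fun b => h ⟨ρ 1 • b, smul_mem_unitalPart ρ 1 b⟩, fun b b' => ?_⟩, fun s b => ?_⟩,
    fun a => ?_⟩
  · rw [← AddSubmonoid.coe_add, ← map_add]
    exact congrArg (fun x => (h x : M)) (Subtype.ext (smul_add _ _ _))
  · obtain ⟨r, h1, h2⟩ := hρ s
    have hx (x : unitalPart ρ M) : s • (x : M) = ρ r • (x : M) := by
      have hx : ρ 1 • (x : M) = x := x.2
      rw [← hx, ← mul_smul, h2, ← mul_smul, ← map_mul, mul_one]
    simp only [RingHom.id_apply]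
    rw [hx, ← coe_smul_unitalPart, ← map_smul]
    refine congrArg (fun x => (h x : M)) (Subtype.ext ?_)
    change ρ 1 • s • b = ρ r • ρ 1 • b
    rw [← mul_smul, ← mul_smul, h1, ← map_mul, mul_one]
  · have := LinearMap.congr_fun hh ⟨ρ 1 • a, smul_mem_unitalPart ρ 1 a⟩
    have h3 := congrArg Subtype.val this
    refine Eq.trans ?_ (h3.trans (map_smul φ _ _))
    exact congrArg (fun x => (h x : M)) (Subtype.ext (map_smul f _ _).symm)

/-- With `d` as `-c`, take the difference `c • ψ - c • φ` for `α` and `0` for `β`. -/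
theorem hasDifference_of_add_eq_zero {c d : S} (hc : ∀ s, c * s = s * c) (hd : ∀ s, d * s = s * d)
    (h : c + d = 0) (M : Type u) [AddCommMonoid M] [Module S M] : HasDifference M c := by
  intro A B _ _ _ _ f _ φ ψ e
  refine ⟨⟨⟨fun b => c • ψ b + d • φ b, fun b b' => ?_⟩, fun s b => ?_⟩, 0, fun a => ?_,
    fun a => rfl, fun b => ?_⟩
  · rw [map_add, map_add, smul_add, smul_add, add_add_add_comm]
  · simp only [RingHom.id_apply]
    rw [map_smul, map_smul, smul_add, ← mul_smul, ← mul_smul, ← mul_smul, ← mul_smul, hc, hd]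
  · change c • ψ (f a) + d • φ (f a) = 0
    rw [e, ← add_smul, h, zero_smul]
  · change c • φ b + (c • ψ b + d • φ b) = c • ψ b + 0
    rw [add_left_comm, ← add_smul, h, zero_smul]

end Ring

/-! ### The atomic summands. -/

section Boolean

variable {S : Type u} [Semiring S]

/-- A central additively and multiplicatively idempotent element each of whose multiples is
`0` or itself. -/
structure IsBooleanAtom (t : S) : Prop where
  add_self : t + t = t
  mul_self : t * t = t
  mul_comm : ∀ s, t * s = s * t
  eq_or : ∀ s, t * s = t ∨ t * s = 0

variable {t : S} {M : Type u} [AddCommMonoid M] [Module S M]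

/-- Scalars act on `t M` as `0` or `1`, so the sum of a finite generating set bounds everything. -/
theorem IsBooleanAtom.exists_top (ht : IsBooleanAtom t) [Module.Finite S M] :
    ∃ m : M, ∀ x : M, t • x + t • m = t • m := by
  obtain ⟨G, hG⟩ := Module.Finite.fg_top (R := S) (M := M)
  have ht2 (x : M) : t • x + t • x = t • x := by rw [← add_smul, ht.add_self]
  refine ⟨∑ g ∈ G, g, fun x => ?_⟩
  have hx : x ∈ Submodule.span S (G : Set M) := hG ▸ Submodule.mem_top
  classical
  induction hx using Submodule.span_induction with
  | mem x hx => rw [← Finset.add_sum_erase G _ hx, smul_add, ← add_assoc, ht2]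
  | zero => rw [smul_zero, zero_add]
  | add x y _ _ hx hy => rw [smul_add, add_assoc, hy, hx]
  | smul s x _ hx =>
    rw [← mul_smul]
    rcases ht.eq_or s with h | h
    · rw [h, hx]
    · rw [h, zero_smul, zero_add]

theorem IsBooleanAtom.exists_extension (ht : IsBooleanAtom t) {m : M}
    (hm : ∀ x : M, t • x + t • m = t • m) {A B : Type u} [AddCommMonoid A] [AddCommMonoid B]
    [Module S A] [Module S B] (f : A →ₗ[S] B) (hf' : IsSubtractive (LinearMap.range f))
    (φ : A →ₗ[S] M) (hφ : ∀ a a', f a = f a' → φ a = φ a') :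
    ∃ ψ : B →ₗ[S] M, (∀ a, ψ (f a) = t • φ a) ∧
      ∀ b, t • b ∉ LinearMap.range f → ψ b = t • m := by
  classical
  have hex (b : B) : ∃ y : M, (∀ a, f a = t • b → y = t • φ a) ∧
      (t • b ∉ LinearMap.range f → y = t • m) := by
    by_cases hb : t • b ∈ LinearMap.range f
    · obtain ⟨a, ha⟩ := hb
      exact ⟨t • φ a, fun a' ha' => by rw [hφ a a' (ha.trans ha'.symm)],
        fun h => absurd ⟨a, ha⟩ h⟩
    · exact ⟨t • m, fun a ha => absurd ⟨a, ha⟩ hb, fun _ => rfl⟩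
  choose ψ h1 h2 using hex
  -- A sum leaves the image as soon as one summand does; the top value then absorbs the other, which
  -- gives additivity.
  have hle (b b' : B) (h : t • (b + b') ∈ LinearMap.range f) : t • b ∈ LinearMap.range f := by
    refine hf' (t • (b + b')) (t • b) h ?_
    rwa [← smul_add, add_right_comm, smul_add, smul_add, ← add_smul, ht.add_self, ← smul_add]
  have hψ (b : B) : ∃ y, ψ b = t • y := by
    by_cases hb : t • b ∈ LinearMap.range f
    · obtain ⟨a, ha⟩ := hb
      exact ⟨_, h1 b a ha⟩
    · exact ⟨_, h2 b hb⟩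
  have hadd (b b' : B) (hb : t • b ∉ LinearMap.range f) : ψ (b + b') = ψ b + ψ b' := by
    obtain ⟨y, hy⟩ := hψ b'
    rw [h2 b hb, h2 _ fun h => hb (hle _ _ h), hy, add_comm, hm]
  refine ⟨⟨⟨ψ, fun b b' => ?_⟩, fun s b => ?_⟩, fun a => ?_, h2⟩
  · by_cases hb : t • b ∈ LinearMap.range f
    · by_cases hb' : t • b' ∈ LinearMap.range f
      · obtain ⟨a, ha⟩ := hb
        obtain ⟨a', ha'⟩ := hb'
        rw [h1 b a ha, h1 b' a' ha', h1 (b + b') (a + a') (by rw [map_add, ha, ha', smul_add]),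
          map_add, smul_add]
      · rw [add_comm, hadd b' b hb', add_comm]
    · exact hadd b b' hb
  · simp only [RingHom.id_apply]
    have htt (y : M) : s • t • y = (t * s) • y := by rw [ht.mul_comm, mul_smul]
    rcases ht.eq_or s with h | h
    · have hsb : t • s • b = t • b := by rw [← mul_smul, h]
      by_cases hb : t • b ∈ LinearMap.range f
      · obtain ⟨a, ha⟩ := hb
        rw [h1 b a ha, h1 (s • b) a (ha.trans hsb.symm), htt, h]
      · rw [h2 b hb, h2 (s • b) (hsb ▸ hb), htt, h]
    · obtain ⟨y, hy⟩ := hψ b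
      rw [hy, htt, h, zero_smul, h1 (s • b) 0 (by rw [map_zero, ← mul_smul, h, zero_smul]),
        map_zero, smul_zero]
  · change ψ (f a) = _
    rw [h1 (f a) (t • a) (map_smul f _ _), map_smul, ← mul_smul, ht.mul_self]

theorem IsBooleanAtom.hasExtension (ht : IsBooleanAtom t) [Module.Finite S M] :
    HasExtension M t := by
  intro A B _ _ _ _ f hf hf' φ
  obtain ⟨m, hm⟩ := ht.exists_top (M := M)
  obtain ⟨ψ, hψ, -⟩ := ht.exists_extension hm f hf' φ fun a a' e => congrArg φ (hf e)
  exact ⟨ψ, hψ⟩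

/-- Extend `0` by the top element outside the image: adding this map erases any difference there. -/
theorem IsBooleanAtom.hasDifference (ht : IsBooleanAtom t) [Module.Finite S M] :
    HasDifference M t := by
  intro A B _ _ _ _ f hf' φ ψ e
  obtain ⟨m, hm⟩ := ht.exists_top (M := M)
  obtain ⟨α, hα, hα'⟩ := ht.exists_extension hm f hf' 0 fun _ _ _ => rfl
  have hα0 (a : A) : α (f a) = 0 := by rw [hα, LinearMap.zero_apply, smul_zero]
  refine ⟨α, α, hα0, hα0, fun b => ?_⟩
  by_cases hb : t • b ∈ LinearMap.range f
  · obtain ⟨a, ha⟩ := hb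
    rw [← map_smul, ← map_smul, ← ha, e]
  · rw [hα' b hb, hm, hm]

theorem exists_sum_eq_one {T : Type u} [Semiring T] [Finite T] (hT : IsBooleanAlgebra T) :
    ∃ G : Finset T, (∀ t ∈ G, IsBooleanAtom t) ∧ ∑ t ∈ G, t = 1 := by
  classical
  obtain ⟨_, hsup, hinf, hbot, htop⟩ := hT
  have : Fintype T := Fintype.ofFinite T
  have hG (t : T) : t ∈ ({t | IsAtom t} : Finset T) ↔ IsAtom t := by simp
  refine ⟨({t | IsAtom t} : Finset T), fun t ht => ?_, ?_⟩
  · refine ⟨by rw [hsup, sup_idem], by rw [hinf, inf_idem], fun s => by rw [hinf, hinf, inf_comm],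
      fun s => ?_⟩
    rw [hinf, hbot]
    exact (((hG t).1 ht).le_iff.1 (inf_le_left : t ⊓ s ≤ t)).symm
  · set u := ∑ t ∈ ({t | IsAtom t} : Finset T), t with hu
    rw [htop, ← compl_eq_bot]
    rcases eq_bot_or_exists_atom_le uᶜ with h | ⟨a, ha, hau⟩
    · exact h
    · have h : a * u = a := by
        rw [hu, Finset.mul_sum, Finset.sum_eq_single_of_mem a ((hG a).2 ha), hinf, inf_idem]
        intro b hb hba
        rw [hinf, hbot]
        exact (ha.disjoint_of_ne ((hG b).1 hb) hba.symm).eq_bot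
      rw [hinf, inf_eq_left] at h
      exact absurd (le_bot_iff.1 (disjoint_compl_right h hau)) ha.1

end Boolean

/-! ### Assembly of the summands. -/

theorem eInjective_of_ringEquiv {S R T : Type u} [Semiring S] [Ring R] [Semiring T]
    [IsSemisimpleRing R] [Finite T] (hT : IsBooleanAlgebra T) (E : S ≃+* R × T)
    (M : Type u) [AddCommMonoid M] [Module S M] [Module.Finite S M] : EInjective S M := by
  obtain ⟨G, hG, hG1⟩ := exists_sum_eq_one hT
  let ρ : R →ₙ+* S :=
    { toFun := fun r => E.symm (r, 0)
      map_mul' := fun r s => by rw [← map_mul, Prod.mk_mul_mk, mul_zero]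
      map_zero' := map_zero E.symm
      map_add' := fun r s => by rw [← map_add, Prod.mk_add_mk, add_zero] }
  let τ : T →+ S := E.symm.toAddMonoidHom.comp (AddMonoidHom.inr R T)
  have hτ (t : T) : τ t = E.symm (0, t) := rfl
  have hρ (r : R) : ρ r = E.symm (r, 0) := rfl
  have hone : ρ 1 + ∑ t ∈ G, τ t = 1 := by
    rw [← map_sum, hG1, hρ, hτ, ← map_add, Prod.mk_add_mk, add_zero, zero_add]
    exact map_one E.symm
  have hatom (t : T) (ht : t ∈ G) : IsBooleanAtom (τ t) := by
    have h := hG t ht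
    have hmul (s : S) : τ t * s = τ (t * (E s).2) := by
      apply E.injective
      rw [map_mul, hτ, hτ, E.apply_symm_apply, E.apply_symm_apply]
      exact Prod.ext (zero_mul _) rfl
    refine ⟨by rw [← map_add, h.add_self], ?_, fun s => ?_, fun s => ?_⟩
    · rw [hmul, hτ t, E.apply_symm_apply, h.mul_self, hτ]
    · apply E.injective
      rw [map_mul, map_mul, hτ, E.apply_symm_apply]
      exact Prod.ext ((zero_mul _).trans (mul_zero _).symm) (h.mul_comm _)
    · rw [hmul]
      rcases h.eq_or (E s).2 with h | h
      · exact Or.inl (by rw [h])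
      · exact Or.inr (by rw [h, map_zero])
  have hρ1 (s : S) : ∃ r, ρ 1 * s = ρ r ∧ s * ρ 1 = ρ r := by
    refine ⟨(E s).1, ?_, ?_⟩ <;> apply E.injective <;>
      rw [map_mul, hρ, hρ, E.apply_symm_apply, E.apply_symm_apply]
    · exact Prod.ext (one_mul _) (zero_mul _)
    · exact Prod.ext (mul_one _) (mul_zero _)
  have hneg (s : S) : ρ (-1) * s = s * ρ (-1) := by
    apply E.injective
    rw [map_mul, map_mul, hρ, E.apply_symm_apply]
    refine Prod.ext ?_ ((zero_mul _).trans (mul_zero _).symm)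
    change -1 * (E s).1 = (E s).1 * -1
    rw [neg_one_mul, mul_neg_one]
  refine .of_hasExtension_one ?_ ?_
  · rw [← hone]
    exact (hasExtension_of_isSemisimpleRing ρ hρ1 M).add
      (Finset.sum_induction _ _ (fun _ _ => .add) .zero fun t ht => (hatom t ht).hasExtension)
  · rw [← hone]
    refine (hasDifference_of_add_eq_zero (fun s => ?_) hneg (d := ρ (-1)) ?_ M).add
      (Finset.sum_induction _ _ (fun _ _ => .add) .zero fun t ht => (hatom t ht).hasDifference)
    · obtain ⟨r, h1, h2⟩ := hρ1 s
      rw [h1, h2]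
    · rw [← map_add, add_neg_cancel, map_zero]

end EInj

theorem theorem6p7 (S : Type u) [Semiring S] (hS : EInj.IsLeftSubtractive S) :
    List.TFAE [
      ∀ (M : Type u) [AddCommMonoid M] [Module S M], Module.Finite S M → EInj.EInjective S M,
      ∀ (M : Type u) [AddCommMonoid M] [Module S M], Module.IsPrincipal S M → EInj.EInjective S M,
      ∃ (R T : Type u) (_ : Ring R) (_ : Semiring T),
        IsSemisimpleRing R ∧ EInj.IsBooleanAlgebra T ∧ Finite T ∧ Nonempty (S ≃+* R × T)] := by
  tfae_have 1 → 2 := fun h M _ _ hM => h M ⟨by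
    obtain ⟨m, hm⟩ := hM
    exact hm ▸ Submodule.fg_span_singleton m⟩
  tfae_have 2 → 3 := fun h => EInj.exists_ringEquiv_of_eInjective hS h
  tfae_have 3 → 1 := by
    rintro ⟨R, T, _, _, hR, hT, hfin, ⟨E⟩⟩ M _ _ hM
    exact EInj.eInjective_of_ringEquiv hT E M
  tfae_finish
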